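/- **Proposition (essential self-adjointness of the Nelson Hamiltonian).** Let $d\ge 1$, $\varepsilon>0$, $M>0$, $m_0\ge 0$, and $\omega(k)=\sqrt{|k|^2+m_0^2}$ for $k\in\mathbb R^d$. Let $V\in L^2_{loc}(\mathbb R^d)$ with $V\ge 0$ almost everywhere, and let $\chi:\mathbb R^d\to\mathbb C$ be such that $f:=\omega^{-1/2}\chi\in L^2(\mathbb R^d)$. On the Fock space $$\mathscr H=\Gamma_s(L^2(\mathbb R^d)\oplus L^2(\mathbb R^d))\simeq\bigoplus_{n,m\ge 0}L^2_s(\mathbb R^{nd})\otimes L^2_s(\mathbb R^{md})$$ ($n$ nucleons, with annihilation and creation operators $\psi,\psi^*$, and $m$ mesons, with $a,a^*$, where $[\psi(x),\psi^*(y)]=\varepsilon\,\delta(x-y)$ and $[a(k),a^*(l)]=\varepsilon\,\delta(k-l)$) let $H=H_0+H_I$ be the Nelson Hamiltonian, where $$H_0=d\Gamma\Bigl(-\frac{\Delta}{2M}+V\Bigr)\otimes 1+1\otimes d\Gamma(\omega)$$ is self-adjoint on its natural domain $D(H_0)$ (with $-\frac{\Delta}{2M}+V$ the positive self-adjoint operator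 on $L^2(\mathbb R^d)$ extending the one on $C_0^\infty(\mathbb R^d)$; on the $(n,m)$ sector $H_0$ is $\varepsilon\bigl(\sum_{j\le n}(-\frac{\Delta_{x_j}}{2M}+V(x_j))+\sum_{l\le m}\omega(k_l)\bigr)$), and $$H_I=\int_{\mathbb R^{2d}}\frac{1}{\sqrt{\omega(k)}}\,\psi^*(x)\bigl(\chi(k)\,a^*(k)e^{-ik\cdot x}+\overline{\chi(k)}\,a(k)e^{ik\cdot x}\bigr)\psi(x)\,dk\,dx ,$$ that is, $H_I=\varepsilon\sum_{j=1}^{n}\bigl(a^*(f e^{-ik\cdot x_j})+a(f e^{-ik\cdot x_j})\bigr)$ on the vectors with $n$ nucleons. Let $\mathscr F_0\subset\mathscr H$ be the subspace of vectors with finitely many nucleons and mesons, i.e. with only finitely many nonzero $(n,m)$ components. Then $H$ is essentially self-adjoint on $D(H_0)\cap\mathscr F_0$: this subspace is dense and contained in the domain of $H$, and the restriction of $H$ to it is closable with self-adjoint closure. -/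

import Mathlib

open MeasureTheory
open scoped ContDiff

noncomputable section

namespace Nelson

/-! ### Essential self-adjointness -/

/-- The (unbounded) operator `T` on a Hilbert space is essentially self-adjoint on the subspace
`D`: `T` is defined on `D`, `D` is dense, and the restriction of `T` to `D` is closable with
self-adjoint closure. -/
def IsEssentiallySelfAdjointOn {F : Type*} [NormedAddCommGroup F] [InnerProductSpace ℂ F]
    [CompleteSpace F] (T : F →ₗ.[ℂ] F) (D : Submodule ℂ F) : Prop :=
  D ≤ T.domain ∧ Dense (D : Set F) ∧ (T.domRestrict D).IsClosable ∧
    IsSelfAdjoint (T.domRestrict D).closure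

/-! ### Sectors with a fixed number of nucleons and mesons -/

/-- The space `ℝ^d` (position of a nucleon, or momentum of a meson). -/
abbrev Space (d : ℕ) : Type := EuclideanSpace ℝ (Fin d)

/-- Positions `x_1, …, x_n` of `n` nucleons and momenta `k_1, …, k_m` of `m` mesons. -/
abbrev Config (d n m : ℕ) : Type := (Fin n → Space d) × (Fin m → Space d)

/-- `L²(ℝ^{nd} × ℝ^{md}) = L²(ℝ^{nd}) ⊗ L²(ℝ^{md})`. -/
abbrev L2 (d n m : ℕ) : Type := Lp ℂ 2 (volume : Measure (Config d n m))

/-- Permutation of the nucleons by `σ` and of the mesons by `τ`. -/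
def permute (d : ℕ) {n m : ℕ} (σ : Equiv.Perm (Fin n)) (τ : Equiv.Perm (Fin m)) :
    Config d n m → Config d n m :=
  fun p => (p.1 ∘ σ, p.2 ∘ τ)

lemma measurePreserving_comp_perm (d : ℕ) {n : ℕ} (σ : Equiv.Perm (Fin n)) :
    MeasurePreserving (fun x : Fin n → Space d => x ∘ σ) volume volume := by
  have h := volume_measurePreserving_piCongrLeft (fun _ : Fin n => Space d) σ.symm
  have e : (fun x : Fin n → Space d => x ∘ σ) =
      MeasurableEquiv.piCongrLeft (fun _ : Fin n => Space d) σ.symm := by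
    funext x j
    have := Equiv.piCongrLeft_apply_apply (fun _ : Fin n => Space d) σ.symm x (σ j)
    rw [Equiv.symm_apply_apply] at this
    exact this.symm
  rw [e]
  exact h

lemma measurePreserving_permute (d : ℕ) {n m : ℕ} (σ : Equiv.Perm (Fin n))
    (τ : Equiv.Perm (Fin m)) :
    MeasurePreserving (permute d σ τ) (volume : Measure (Config d n m)) volume :=
  (measurePreserving_comp_perm d σ).prod (measurePreserving_comp_perm d τ)

/-- The sector `L²_s(ℝ^{nd}) ⊗ L²_s(ℝ^{md})`: the functions `φ(x_1, …, x_n; k_1, …, k_m)` in `L²`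
that are symmetric in the `x_j` and symmetric in the `k_l`. -/
def sector (d n m : ℕ) : Submodule ℂ (L2 d n m) where
  carrier := {φ | ∀ (σ : Equiv.Perm (Fin n)) (τ : Equiv.Perm (Fin m)),
    Lp.compMeasurePreserving (permute d σ τ) (measurePreserving_permute d σ τ) φ = φ}
  add_mem' := fun {a b} ha hb σ τ => by rw [map_add, ha σ τ, hb σ τ]
  zero_mem' := fun σ τ => map_zero _
  smul_mem' := fun c a ha σ τ => by
    have h := (Lp.compMeasurePreservingₗ ℂ (permute d σ τ) (E := ℂ) (p := 2)
      (measurePreserving_permute (n := n) (m := m) d σ τ)).map_smul c a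
    exact h.trans (congrArg (c • ·) (ha σ τ))

lemma isClosed_sector (d n m : ℕ) : IsClosed (sector d n m : Set (L2 d n m)) := by
  have : (sector d n m : Set (L2 d n m)) = ⋂ (σ : Equiv.Perm (Fin n)) (τ : Equiv.Perm (Fin m)),
      {φ | Lp.compMeasurePreserving (permute d σ τ) (measurePreserving_permute d σ τ) φ = φ} := by
    ext φ
    simp only [Set.mem_iInter]
    exact Iff.rfl
  rw [this]
  exact isClosed_iInter fun σ => isClosed_iInter fun τ =>
    isClosed_eq (Lp.isometry_compMeasurePreserving (measurePreserving_permute d σ τ)).continuous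
      continuous_id

instance instCompleteSpaceSector (d n m : ℕ) : CompleteSpace (sector d n m) :=
  (isClosed_sector d n m).completeSpace_coe

/-- The Fock space `Γ_s(L²(ℝ^d) ⊕ L²(ℝ^d)) = Γ_s(L²(ℝ^d)) ⊗ Γ_s(L²(ℝ^d))`, as the Hilbert direct
sum of its sectors. -/
abbrev Fock (d : ℕ) : Type := lp (fun N : ℕ × ℕ => sector d N.1 N.2) 2

/-- The finite particle vectors: only finitely many components are nonzero. -/
def finiteParticle (d : ℕ) : Submodule ℂ (Fock d) where
  carrier := {φ | {N : ℕ × ℕ | φ N ≠ 0}.Finite}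
  add_mem' := fun {a b} ha hb => (ha.union hb).subset fun N hN => by
    by_contra h
    simp only [Set.mem_union, Set.mem_ofPred_eq, not_or, not_not] at h
    exact hN (by rw [lp.coeFn_add, Pi.add_apply, h.1, h.2, add_zero])
  zero_mem' := by simp
  smul_mem' := fun c a ha => ha.subset fun N hN h => hN (by
    rw [lp.coeFn_smul, Pi.smul_apply, h, smul_zero])

/-! ### The free Hamiltonian -/

/-- The dispersion relation `ω(k) = √(k² + m₀²)` of the mesons. -/
def omega {d : ℕ} (m₀ : ℝ) (k : Space d) : ℝ := Real.sqrt (‖k‖ ^ 2 + m₀ ^ 2)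

/-- The unit vector of configuration space in the direction of the `i`-th coordinate of the
`j`-th nucleon. -/
def nucleonDir (d n m : ℕ) (j : Fin n) (i : Fin d) : Config d n m :=
  (Pi.single j (EuclideanSpace.single i 1), 0)

/-- `Du j i` is the weak (distributional) derivative of `u` with respect to the `i`-th coordinate
of the `j`-th nucleon, for all `j` and `i`. -/
def IsWeakGradient {d n m : ℕ} (u : L2 d n m) (Du : Fin n → Fin d → L2 d n m) : Prop :=
  ∀ (j : Fin n) (i : Fin d) (g : Config d n m → ℝ), ContDiff ℝ ∞ g → HasCompactSupport g →
    ∫ p, (fderiv ℝ g p (nucleonDir d n m j i)) • u p = - ∫ p, g p • Du j i p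

/-- The total potential `∑_j V(x_j) + ∑_l ω(k_l)`, acting by multiplication. -/
def potential {d n m : ℕ} (m₀ : ℝ) (V : Space d → ℝ) (p : Config d n m) : ℝ :=
  ∑ j, V (p.1 j) + ∑ l, omega m₀ (p.2 l)

/-- `u` (with weak gradient `Du ∈ L²`) lies in the form domain of `H₀`. -/
def InFormDomain {d n m : ℕ} (m₀ : ℝ) (V : Space d → ℝ) (u : L2 d n m)
    (Du : Fin n → Fin d → L2 d n m) : Prop :=
  IsWeakGradient u Du ∧
    MemLp (fun p => (Real.sqrt (potential m₀ V p) : ℂ) * u p) 2 (volume : Measure (Config d n m))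

/-- The quadratic form of `H₀`,
`ε (1/(2M) ∑_j ⟨∇_{x_j} v, ∇_{x_j} u⟩ + ⟨v, (∑_j V(x_j) + ∑_l ω(k_l)) u⟩)`. -/
def freeForm {d n m : ℕ} (ε M m₀ : ℝ) (V : Space d → ℝ)
    (v : L2 d n m) (Dv : Fin n → Fin d → L2 d n m)
    (u : L2 d n m) (Du : Fin n → Fin d → L2 d n m) : ℂ :=
  ε * ((1 / (2 * M) : ℝ) * (∑ j, ∑ i, inner ℂ (Dv j i) (Du j i)) +
    ∫ p : Config d n m, inner ℂ ((Real.sqrt (potential m₀ V p) : ℂ) * v p)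
      ((Real.sqrt (potential m₀ V p) : ℂ) * u p))

lemma inFormDomain_zero {d n m : ℕ} {m₀ : ℝ} {V : Space d → ℝ} :
    InFormDomain m₀ V (0 : L2 d n m) (fun _ _ => 0) := by
  refine ⟨fun j i g _ _ => ?_, ?_⟩
  · have h := Lp.coeFn_zero ℂ 2 (volume : Measure (Config d n m))
    rw [integral_eq_zero_of_ae (h.mono fun p hp => by rw [hp]; exact smul_zero _),
      integral_eq_zero_of_ae (h.mono fun p hp => by rw [hp]; exact smul_zero _), neg_zero]
  · refine (memLp_congr_ae ?_).2 (MemLp.zero (p := 2) (ε := ℂ))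
    filter_upwards [Lp.coeFn_zero ℂ 2 (volume : Measure (Config d n m))] with p hp
    rw [hp]
    exact mul_zero _

lemma integrable_test_smul {d n m : ℕ} {h : Config d n m → ℝ} (hc : Continuous h)
    (hs : HasCompactSupport h) (u : L2 d n m) : Integrable (fun p => h p • u p) volume :=
  ((Lp.memLp u).locallyIntegrable one_le_two).integrable_smul_left_of_hasCompactSupport hc hs

lemma integrable_inner_of_memLp {d n m : ℕ} {a b : Config d n m → ℂ} (ha : MemLp a 2 volume)
    (hb : MemLp b 2 volume) : Integrable (fun p => inner ℂ (a p) (b p)) volume := by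
  refine (L2.integrable_inner (𝕜 := ℂ) (ha.toLp a) (hb.toLp b)).congr ?_
  filter_upwards [ha.coeFn_toLp, hb.coeFn_toLp] with p h1 h2
  rw [h1, h2]

lemma InFormDomain.add {d n m : ℕ} {m₀ : ℝ} {V : Space d → ℝ} {u u' : L2 d n m}
    {Du Du' : Fin n → Fin d → L2 d n m} (h : InFormDomain m₀ V u Du)
    (h' : InFormDomain m₀ V u' Du') :
    InFormDomain m₀ V (u + u') (fun j i => Du j i + Du' j i) := by
  refine ⟨fun j i g hg hgs => ?_, ?_⟩
  · have hd : Continuous fun p => fderiv ℝ g p (nucleonDir d n m j i) :=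
      (hg.continuous_fderiv (by simp)).clm_apply continuous_const
    have hds : HasCompactSupport fun p => fderiv ℝ g p (nucleonDir d n m j i) :=
      hgs.fderiv_apply ℝ _
    have e1 : ∫ p, fderiv ℝ g p (nucleonDir d n m j i) • (u + u' : L2 d n m) p =
        ∫ p, (fderiv ℝ g p (nucleonDir d n m j i) • u p +
          fderiv ℝ g p (nucleonDir d n m j i) • u' p) :=
      integral_congr_ae ((Lp.coeFn_add u u').mono fun p hp => by
        simp only [hp, Pi.add_apply, smul_add])
    have e2 : ∫ p, g p • (Du j i + Du' j i : L2 d n m) p =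
        ∫ p, (g p • Du j i p + g p • Du' j i p) :=
      integral_congr_ae ((Lp.coeFn_add (Du j i) (Du' j i)).mono fun p hp => by
        simp only [hp, Pi.add_apply, smul_add])
    rw [e1, e2, integral_add (integrable_test_smul hd hds u) (integrable_test_smul hd hds u'),
      integral_add (integrable_test_smul hg.continuous hgs _)
        (integrable_test_smul hg.continuous hgs _), h.1 j i g hg hgs, h'.1 j i g hg hgs]
    ring
  · refine (memLp_congr_ae ?_).2 (h.2.add h'.2)
    filter_upwards [Lp.coeFn_add u u'] with p hp
    simp only [hp, Pi.add_apply, mul_add]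

lemma InFormDomain.smul {d n m : ℕ} {m₀ : ℝ} {V : Space d → ℝ} {u : L2 d n m}
    {Du : Fin n → Fin d → L2 d n m} (h : InFormDomain m₀ V u Du) (c : ℂ) :
    InFormDomain m₀ V (c • u) (fun j i => c • Du j i) := by
  refine ⟨fun j i g hg hgs => ?_, ?_⟩
  · have e1 : ∫ p, fderiv ℝ g p (nucleonDir d n m j i) • (c • u : L2 d n m) p =
        ∫ p, c • (fderiv ℝ g p (nucleonDir d n m j i) • u p) :=
      integral_congr_ae ((Lp.coeFn_smul c u).mono fun p hp => by
        simp only [hp, Pi.smul_apply]; exact smul_comm _ _ _)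
    have e2 : ∫ p, g p • (c • Du j i : L2 d n m) p = ∫ p, c • (g p • Du j i p) :=
      integral_congr_ae ((Lp.coeFn_smul c (Du j i)).mono fun p hp => by
        simp only [hp, Pi.smul_apply]; exact smul_comm _ _ _)
    rw [e1, e2, integral_smul, integral_smul, h.1 j i g hg hgs, smul_neg]
  · refine (memLp_congr_ae ?_).2 (h.2.const_smul c)
    filter_upwards [Lp.coeFn_smul c u] with p hp
    simp only [hp, Pi.smul_apply, smul_eq_mul]
    ring

lemma freeForm_zero {d n m : ℕ} {ε M m₀ : ℝ} {V : Space d → ℝ} (v : L2 d n m)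
    (Dv : Fin n → Fin d → L2 d n m) :
    freeForm ε M m₀ V v Dv (0 : L2 d n m) (fun _ _ => 0) = 0 := by
  unfold freeForm
  rw [integral_eq_zero_of_ae
    ((Lp.coeFn_zero ℂ 2 (volume : Measure (Config d n m))).mono fun p hp => by
      simp only [hp, Pi.zero_apply, mul_zero, inner_zero_right])]
  simp

lemma freeForm_smul {d n m : ℕ} {ε M m₀ : ℝ} {V : Space d → ℝ} (c : ℂ) (v : L2 d n m)
    (Dv : Fin n → Fin d → L2 d n m) (u : L2 d n m) (Du : Fin n → Fin d → L2 d n m) :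
    freeForm ε M m₀ V v Dv (c • u) (fun j i => c • Du j i) =
      c * freeForm ε M m₀ V v Dv u Du := by
  unfold freeForm
  rw [integral_congr_ae (g := fun p => c • inner ℂ ((Real.sqrt (potential m₀ V p) : ℂ) * v p)
      ((Real.sqrt (potential m₀ V p) : ℂ) * u p))
    ((Lp.coeFn_smul c u).mono fun p hp => by
      simp only [hp, Pi.smul_apply, smul_eq_mul]
      rw [mul_left_comm, ← smul_eq_mul c, inner_smul_right])]
  rw [integral_smul]
  simp only [inner_smul_right, ← Finset.mul_sum, smul_eq_mul]
  ring

lemma freeForm_add {d n m : ℕ} {ε M m₀ : ℝ} {V : Space d → ℝ} {v u u' : L2 d n m}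
    {Dv Du Du' : Fin n → Fin d → L2 d n m} (hv : InFormDomain m₀ V v Dv)
    (hu : InFormDomain m₀ V u Du) (hu' : InFormDomain m₀ V u' Du') :
    freeForm ε M m₀ V v Dv (u + u') (fun j i => Du j i + Du' j i) =
      freeForm ε M m₀ V v Dv u Du + freeForm ε M m₀ V v Dv u' Du' := by
  unfold freeForm
  rw [integral_congr_ae (g := fun p =>
      inner ℂ ((Real.sqrt (potential m₀ V p) : ℂ) * v p)
        ((Real.sqrt (potential m₀ V p) : ℂ) * u p) +
      inner ℂ ((Real.sqrt (potential m₀ V p) : ℂ) * v p)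
        ((Real.sqrt (potential m₀ V p) : ℂ) * u' p))
    ((Lp.coeFn_add u u').mono fun p hp => by
      simp only [hp, Pi.add_apply, mul_add, inner_add_right]),
    integral_add (integrable_inner_of_memLp hv.2 hu.2) (integrable_inner_of_memLp hv.2 hu'.2)]
  have e : ∑ j, ∑ i, inner ℂ (Dv j i) (Du j i + Du' j i) =
      ∑ j, ∑ i, inner ℂ (Dv j i) (Du j i) + ∑ j, ∑ i, inner ℂ (Dv j i) (Du' j i) := by
    simp only [inner_add_right, Finset.sum_add_distrib]
  rw [e]
  ring

/-- The graph of the restriction of `H₀` to the sector with `n` nucleons and `m` mesons, i.e. of the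
self-adjoint operator `ε (∑_j (-Δ_{x_j}/(2M) + V(x_j)) + ∑_l ω(k_l))`, given as the operator
associated with its closed quadratic form (for `0 ≤ V ∈ L²_loc` this is the unique self-adjoint
extension of the differential operator on test functions): `(u, w)` lies in the graph iff `u` lies in the form
domain and `q(v, u) = ⟨v, w⟩` for every `v` in the form domain. -/
def freeSectorGraph (d n m : ℕ) (ε M m₀ : ℝ) (V : Space d → ℝ) :
    Submodule ℂ (sector d n m × sector d n m) where
  carrier := {z | ∃ Du : Fin n → Fin d → L2 d n m, InFormDomain m₀ V (z.1 : L2 d n m) Du ∧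
    ∀ (v : sector d n m) (Dv : Fin n → Fin d → L2 d n m), InFormDomain m₀ V (v : L2 d n m) Dv →
      freeForm ε M m₀ V (v : L2 d n m) Dv (z.1 : L2 d n m) Du = inner ℂ v z.2}
  add_mem' := by
    rintro ⟨u, w⟩ ⟨u', w'⟩ ⟨Du, hu, h⟩ ⟨Du', hu', h'⟩
    refine ⟨fun j i => Du j i + Du' j i, hu.add hu', fun v Dv hv => ?_⟩
    refine (freeForm_add hv hu hu').trans ?_
    rw [h v Dv hv, h' v Dv hv]
    exact (inner_add_right v w w').symm
  zero_mem' := ⟨fun _ _ => 0, inFormDomain_zero, fun v Dv hv => by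
    refine (freeForm_zero v.1 Dv).trans ?_
    exact (inner_zero_right v).symm⟩
  smul_mem' := by
    rintro c ⟨u, w⟩ ⟨Du, hu, h⟩
    refine ⟨fun j i => c • Du j i, hu.smul c, fun v Dv hv => ?_⟩
    refine (freeForm_smul c v.1 Dv u.1 Du).trans ?_
    rw [h v Dv hv]
    exact (inner_smul_right v w c).symm

/-- The free Hamiltonian `H₀ = dΓ(-Δ/(2M) + V) ⊗ 1 + 1 ⊗ dΓ(ω)` on the Fock space with its natural
domain: the direct sum of its restrictions to the sectors. (For `V ≥ 0` in `L²_loc` the form domains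
contain the symmetric test functions, hence are dense, so that the relation below is the graph of an
operator.) -/
def freeHamiltonian (d : ℕ) (ε M m₀ : ℝ) (V : Space d → ℝ) : Fock d →ₗ.[ℂ] Fock d :=
  Submodule.toLinearPMap
    { carrier := {z : Fock d × Fock d | ∀ N : ℕ × ℕ,
        (z.1 N, z.2 N) ∈ freeSectorGraph d N.1 N.2 ε M m₀ V}
      add_mem' := fun ha hb N => (freeSectorGraph d N.1 N.2 ε M m₀ V).add_mem (ha N) (hb N)
      zero_mem' := fun N => (freeSectorGraph d N.1 N.2 ε M m₀ V).zero_mem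
      smul_mem' := fun c _ ha N => (freeSectorGraph d N.1 N.2 ε M m₀ V).smul_mem c (ha N) }

/-! ### The interaction -/

/-- The form factor `f(k) = ω(k)^{-1/2} χ(k)`. -/
def formFactor {d : ℕ} (m₀ : ℝ) (χ : Space d → ℂ) (k : Space d) : ℂ :=
  ((Real.sqrt (omega m₀ k))⁻¹ : ℝ) * χ k

/-- `∑_j f(k) e^{-i k · x_j}`. -/
def coupling {d n : ℕ} (f : Space d → ℂ) (x : Fin n → Space d) (k : Space d) : ℂ :=
  ∑ j, f k * Complex.exp (-(Complex.I * (inner ℝ k (x j) : ℝ)))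

/-- The function `(x; k_0, …, k_m) ↦ (∑_j f(k_0) e^{-i k_0 · x_j}) u(x; k_1, …, k_m)`. -/
def raiseFun {d n m : ℕ} (f : Space d → ℂ) (u : Config d n m → ℂ) (p : Config d n (m + 1)) : ℂ :=
  coupling f p.1 (p.2 0) * u (p.1, Fin.tail p.2)

lemma measurePreserving_split (d n m : ℕ) :
    MeasurePreserving (fun p : Config d n (m + 1) => (p.2 0, (p.1, Fin.tail p.2)))
      volume ((volume : Measure (Space d)).prod (volume : Measure (Config d n m))) := by
  have h1 : MeasurePreserving
      (fun k : Fin (m + 1) → Space d => (k 0, Fin.tail k)) volume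
      ((volume : Measure (Space d)).prod volume) :=
    volume_preserving_piFinSuccAbove (fun _ : Fin (m + 1) => Space d) 0
  have h2 := (MeasurePreserving.id (volume : Measure (Fin n → Space d))).prod h1
  have h3 := (Measure.measurePreserving_swap.comp h2)
  have h4 := (measurePreserving_prodAssoc (volume : Measure (Space d))
    (volume : Measure (Fin m → Space d)) (volume : Measure (Fin n → Space d))).comp h3
  have h5 := ((MeasurePreserving.id (volume : Measure (Space d))).prod
    (Measure.measurePreserving_swap (μ := (volume : Measure (Fin m → Space d)))
      (ν := (volume : Measure (Fin n → Space d))))).comp h4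
  exact h5

lemma eLpNorm_tensor {d n m : ℕ} {f : Space d → ℂ} (hf : MemLp f 2 volume)
    {u : Config d n m → ℂ} (hu : MemLp u 2 volume) :
    MemLp (fun q : Space d × Config d n m => f q.1 * u q.2) 2 (volume.prod volume) ∧
    eLpNorm (fun q : Space d × Config d n m => f q.1 * u q.2) 2 (volume.prod volume) =
      eLpNorm f 2 volume * eLpNorm u 2 volume := by
  have hnorm : eLpNorm (fun q : Space d × Config d n m => f q.1 * u q.2) 2
      (volume.prod volume) = eLpNorm f 2 volume * eLpNorm u 2 volume := by
    simp only [eLpNorm_eq_lintegral_rpow_enorm_toReal two_ne_zero ENNReal.ofNat_ne_top, enorm_mul]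
    rw [← ENNReal.mul_rpow_of_nonneg _ _ (by positivity),
      ← lintegral_prod_mul (hf.1.enorm.pow_const _) (hu.1.enorm.pow_const _)]
    congr 2
    funext q
    rw [ENNReal.mul_rpow_of_nonneg _ _ (by positivity)]
  refine ⟨⟨hf.1.comp_fst.mul hu.1.comp_snd, ?_⟩, hnorm⟩
  rw [hnorm]
  exact ENNReal.mul_lt_top hf.2 hu.2

lemma norm_coupling_le {d n : ℕ} (f : Space d → ℂ) (x : Fin n → Space d) (k : Space d) :
    ‖coupling f x k‖ ≤ n * ‖f k‖ := by
  refine (norm_sum_le _ _).trans ?_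
  have : ∀ j : Fin n, ‖f k * Complex.exp (-(Complex.I * (inner ℝ k (x j) : ℝ)))‖ = ‖f k‖ := by
    intro j
    rw [norm_mul, ← mul_neg, mul_comm Complex.I, ← Complex.ofReal_neg,
      Complex.norm_exp_ofReal_mul_I, mul_one]
  rw [Finset.sum_congr rfl fun j _ => this j]
  simp

lemma memLp_raiseFun {d n m : ℕ} {f : Space d → ℂ} (hf : MemLp f 2 volume)
    {u : Config d n m → ℂ} (hu : MemLp u 2 volume) :
    MemLp (raiseFun f u) 2 volume ∧ eLpNorm (raiseFun f u) 2 volume ≤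
      ENNReal.ofReal n * (eLpNorm f 2 volume * eLpNorm u 2 volume) := by
  obtain ⟨h1, h2⟩ := eLpNorm_tensor hf hu
  have hs := measurePreserving_split d n m
  have h3 := h1.comp_measurePreserving hs
  have h4 := eLpNorm_comp_measurePreserving (p := 2) h1.1 hs
  have hb : ∀ p, ‖raiseFun f u p‖ ≤ n * ‖((fun q : Space d × Config d n m => f q.1 * u q.2) ∘
      fun p : Config d n (m + 1) => (p.2 0, (p.1, Fin.tail p.2))) p‖ := by
    intro p
    simp only [raiseFun, Function.comp_apply, norm_mul]
    rw [← mul_assoc]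
    gcongr
    exact norm_coupling_le f p.1 (p.2 0)
  have hm : AEStronglyMeasurable (raiseFun f u) (volume : Measure (Config d n (m + 1))) := by
    have e : raiseFun f u = fun p : Config d n (m + 1) =>
        (∑ j, Complex.exp (-(Complex.I * (inner ℝ (p.2 0) (p.1 j) : ℝ)))) *
        ((fun q : Space d × Config d n m => f q.1 * u q.2) ∘
          fun p : Config d n (m + 1) => (p.2 0, (p.1, Fin.tail p.2))) p := by
      funext p
      simp only [raiseFun, coupling, Function.comp_apply, ← Finset.mul_sum]
      ring
    rw [e]
    refine AEStronglyMeasurable.mul (Continuous.aestronglyMeasurable ?_) h3.1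
    fun_prop
  refine ⟨h3.of_le_mul hm (Filter.Eventually.of_forall hb), ?_⟩
  rw [← h2, ← h4]
  exact eLpNorm_le_mul_eLpNorm_of_ae_le_mul (Filter.Eventually.of_forall hb) 2

lemma raiseFun_congr {d n m : ℕ} (f : Space d → ℂ) {u v : Config d n m → ℂ}
    (h : u =ᵐ[volume] v) : raiseFun f u =ᵐ[volume] raiseFun f v := by
  have hq : Measure.QuasiMeasurePreserving
      (fun p : Config d n (m + 1) => (p.1, Fin.tail p.2)) volume volume :=
    Measure.quasiMeasurePreserving_snd.comp (measurePreserving_split d n m).quasiMeasurePreserving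
  filter_upwards [hq.ae_eq_comp h] with p hp
  simp only [raiseFun]
  rw [show u (p.1, Fin.tail p.2) = v (p.1, Fin.tail p.2) from hp]

/-- The bounded operator `u ↦ (x; k_0, …, k_m) ↦ (∑_j f(k_0) e^{-i k_0 · x_j}) u(x; k_1, …, k_m)`
on `L²`. -/
def raise {d : ℕ} (n m : ℕ) {f : Space d → ℂ} (hf : MemLp f 2 volume) :
    L2 d n m →L[ℂ] L2 d n (m + 1) :=
  LinearMap.mkContinuous
    { toFun := fun u => (memLp_raiseFun hf (Lp.memLp u)).1.toLp (raiseFun f u)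
      map_add' := fun u v => by
        rw [← MemLp.toLp_add, MemLp.toLp_eq_toLp_iff]
        refine (raiseFun_congr f (Lp.coeFn_add u v)).trans (Filter.Eventually.of_forall fun p => ?_)
        simp only [raiseFun, Pi.add_apply, mul_add]
      map_smul' := fun c u => by
        rw [RingHom.id_apply, ← MemLp.toLp_const_smul, MemLp.toLp_eq_toLp_iff]
        refine (raiseFun_congr f (Lp.coeFn_smul c u)).trans
          (Filter.Eventually.of_forall fun p => ?_)
        simp only [raiseFun, Pi.smul_apply, smul_eq_mul]
        ring }
    (n * (eLpNorm f 2 volume).toReal) fun u => by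
      simp only [LinearMap.coe_mk, AddHom.coe_mk]
      rw [Lp.norm_toLp]
      have h := ENNReal.toReal_mono (by have := hf.2.ne; have := (Lp.memLp u).2.ne; finiteness)
        (memLp_raiseFun hf (Lp.memLp u)).2
      rw [ENNReal.toReal_mul, ENNReal.toReal_mul, ENNReal.toReal_ofReal (by positivity),
        ← mul_assoc] at h
      exact h

/-- On the sector with `n` nucleons and `m` mesons, the creation operator
`∑_j a*(f e^{-i k · x_j}) = √(ε (m+1)) S (∑_j f e^{-i k · x_j} ⊗ ·)`, where `S` is the
symmetrization, i.e. the orthogonal projection onto the symmetric functions. -/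
def creation {d : ℕ} (n m : ℕ) (ε : ℝ) {f : Space d → ℂ} (hf : MemLp f 2 volume) :
    sector d n m →L[ℂ] sector d n (m + 1) :=
  (Real.sqrt (ε * (m + 1)) : ℂ) •
    ((sector d n (m + 1)).orthogonalProjectionOnto ∘L raise n m hf ∘L (sector d n m).subtypeL)

/-- The annihilation operator `∑_j a(f e^{-i k · x_j})`, the adjoint of the creation operator. -/
def annihilation {d : ℕ} (n m : ℕ) (ε : ℝ) {f : Space d → ℂ} (hf : MemLp f 2 volume) :
    sector d n (m + 1) →L[ℂ] sector d n m :=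
  ContinuousLinearMap.adjoint (creation n m ε hf)

/-- The components of `H_I φ`: on `n` nucleons, `H_I = ε ∑_j (a*(f e^{-ik·x_j}) + a(f e^{-ik·x_j}))`,
where the factor `ε` comes from the commutation relation of `ψ` and `ψ*`. -/
def interactionComponent {d : ℕ} (ε : ℝ) {f : Space d → ℂ} (hf : MemLp f 2 volume) (φ : Fock d) :
    (N : ℕ × ℕ) → sector d N.1 N.2
  | (n, 0) => (ε : ℂ) • annihilation n 0 ε hf (φ (n, 1))
  | (n, m + 1) => (ε : ℂ) • (creation n m ε hf (φ (n, m)) +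
      annihilation n (m + 1) ε hf (φ (n, m + 2)))

lemma interactionComponent_add {d : ℕ} (ε : ℝ) {f : Space d → ℂ} (hf : MemLp f 2 volume)
    (a b : Fock d) : interactionComponent ε hf (a + b) =
      interactionComponent ε hf a + interactionComponent ε hf b := by
  funext N
  obtain ⟨n, _ | m⟩ := N
  · simp only [interactionComponent, Pi.add_apply, lp.coeFn_add, map_add, smul_add]
  · simp only [interactionComponent, Pi.add_apply, lp.coeFn_add, map_add, smul_add]
    abel

lemma interactionComponent_smul {d : ℕ} (ε : ℝ) {f : Space d → ℂ} (hf : MemLp f 2 volume)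
    (c : ℂ) (a : Fock d) : interactionComponent ε hf (c • a) =
      c • interactionComponent ε hf a := by
  funext N
  obtain ⟨n, _ | m⟩ := N
  · simp only [interactionComponent, Pi.smul_apply, lp.coeFn_smul, map_smul]
    exact smul_comm _ _ _
  · simp only [interactionComponent, Pi.smul_apply, lp.coeFn_smul, map_smul, ← smul_add]
    exact smul_comm _ _ _

lemma interactionComponent_zero {d : ℕ} (ε : ℝ) {f : Space d → ℂ} (hf : MemLp f 2 volume) :
    interactionComponent ε hf (0 : Fock d) = 0 := by
  have h := interactionComponent_smul ε hf 0 (0 : Fock d)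
  rwa [zero_smul, zero_smul] at h

/-- The interaction `H_I` on its natural domain: all `φ` for which `H_I φ`, computed
componentwise, lies in the Fock space. -/
def interaction {d : ℕ} (ε : ℝ) {f : Space d → ℂ} (hf : MemLp f 2 volume) :
    Fock d →ₗ.[ℂ] Fock d where
  domain :=
    { carrier := {φ | Memℓp (interactionComponent ε hf φ) 2}
      add_mem' := fun {a b} ha hb => by
        rw [Set.mem_ofPred_eq, interactionComponent_add]
        exact Memℓp.add ha hb
      zero_mem' := by
        rw [Set.mem_ofPred_eq, interactionComponent_zero]
        exact zero_memℓp
      smul_mem' := fun c a ha => by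
        rw [Set.mem_ofPred_eq, interactionComponent_smul]
        exact Memℓp.const_smul ha c }
  toFun :=
    { toFun := fun φ => ⟨interactionComponent ε hf φ, φ.2⟩
      map_add' := fun a b => Subtype.ext (interactionComponent_add ε hf a b)
      map_smul' := fun c a => Subtype.ext (interactionComponent_smul ε hf c a) }

/-- The Nelson Hamiltonian `H = H₀ + H_I`. -/
def nelsonHamiltonian {d : ℕ} (ε M m₀ : ℝ) (V : Space d → ℝ) {χ : Space d → ℂ}
    (hχ : MemLp (formFactor m₀ χ) 2 volume) : Fock d →ₗ.[ℂ] Fock d :=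
  freeHamiltonian d ε M m₀ V + interaction ε hχ

end Nelson

end

/-!
The Hamiltonian `H` preserves the number `n` of nucleons, and for fixed `n` it is a block Jacobi
operator in the number `m` of mesons: `H₀` is diagonal and self-adjoint on each sector, and `H_I`
only connects `m` with `m ± 1`, with blocks of norm at most `C_n √(m+1)`. Essential self-adjointness
on `D(H₀) ∩ F₀` follows without any relative bound of `H_I` by `H₀`, in the way of Carleman's
criterion for Jacobi matrices.

A densely defined symmetric operator without deficiency vectors has a self-adjoint closure
(`isSelfAdjoint_closure_of_deficiency`). Let `x` be a deficiency vector, `T* x = z x` with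
`Im z ≠ 0`. Testing with vectors of `D(H₀)` in a single sector `N`, and using that `H₀` is
self-adjoint there, gives `x_N ∈ D(H₀)` and `H₀ x_N = z x_N - (H_I x)_N`. Hence
`⟨x_N, z x_N - (H_I x)_N⟩` is real. Summing the imaginary parts over `m ≤ L`, the contributions of
`H_I` telescope to the block connecting `L` with `L + 1` (`eq_zero_of_ladder`), so that
`|Im z| ∑_{m ≤ L} ‖x_m‖² ≤ C √(L+1) ‖x_L‖ ‖x_{L+1}‖`. As `‖x_L‖ ‖x_{L+1}‖` is summable in `L`
while `1 / √(L+1)` is not, `x = 0` (`eq_zero_of_mul_sum_sq_le`).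

Self-adjointness of `H₀` on a sector (`mem_freeSectorGraph_of_forall`) is that of the operator of a
closed nonnegative form: the form domain is a Hilbert space, so that the Riesz
representation theorem makes `H₀ + 1` onto (`exists_mem_freeSectorGraph`), and a symmetric operator with this
property contains its adjoint. The form domain is dense because `V ∈ L¹_loc` puts the symmetrized
test functions into it (`eq_zero_of_mem_freeSectorGraph`).
-/

open MeasureTheory
open scoped ContDiff

noncomputable section

namespace Nelson

/-! ### The basic criterion for essential self-adjointness -/

section Criterion

variable {F : Type*} [NormedAddCommGroup F] [InnerProductSpace ℂ F]

lemma mem_graph_adjoint_iff {T : F →ₗ.[ℂ] F} {z : F × F} :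
    z ∈ T.graph.adjoint ↔ ∀ y : T.domain, inner ℂ (T y) z.1 = inner ℂ (y : F) z.2 := by
  simp only [Submodule.mem_adjoint_iff, sub_eq_zero]
  exact ⟨fun h y => h _ _ (T.mem_graph y), fun h a b hab => by
    obtain ⟨y, rfl, rfl⟩ := (T.mem_graph_iff).1 hab
    exact h y⟩

/-- The adjoint of a subspace of `F × F` only depends on its closure. -/
lemma adjoint_topologicalClosure (g : Submodule ℂ (F × F)) :
    g.topologicalClosure.adjoint = g.adjoint := by
  ext z
  simp only [Submodule.mem_adjoint_iff]
  refine ⟨fun h a b hab => h a b (g.le_topologicalClosure hab), fun h a b hab => ?_⟩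
  have hc : IsClosed {p : F × F | inner ℂ p.2 z.1 - inner ℂ p.1 z.2 = 0} :=
    isClosed_eq (by fun_prop) continuous_const
  exact closure_minimal (s := (g : Set (F × F))) (fun p hp => h p.1 p.2 hp) hc hab

variable [CompleteSpace F]

/-- If the deficiency spaces of a symmetric operator vanish, its closure and its adjoint have the
same graph: a vector of `graph T*` orthogonal to `graph T` has the form `(p, q)` with
`T* q = -p` and `T* p = q`, so that `T* (q + i p) = i (q + i p)`. -/
lemma graph_adjoint_eq_topologicalClosure {T : F →ₗ.[ℂ] F} (hd : Dense (T.domain : Set F))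
    (hT : T.IsFormalAdjoint T)
    (hdef : ∀ z : ℂ, z.im ≠ 0 → ∀ x : F,
      (∀ y : T.domain, inner ℂ (T y) x = inner ℂ (y : F) (z • x)) → x = 0) :
    T.graph.topologicalClosure = T.graph.adjoint := by
  have hcl : IsClosed (T.graph.adjoint : Set (F × F)) := by
    have := LinearPMap.adjoint_isClosed hd
    rwa [LinearPMap.IsClosed, LinearPMap.adjoint_graph_eq_graph_adjoint hd] at this
  have hle : T.graph.topologicalClosure ≤ T.graph.adjoint := by
    refine Submodule.topologicalClosure_minimal _ (fun z hz => ?_) hcl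
    obtain ⟨x, hx1, hx2⟩ := (T.mem_graph_iff).1 hz
    rw [mem_graph_adjoint_iff]
    intro y
    rw [← hx1, ← hx2]
    exact hT y x
  refine le_antisymm hle fun z hz => ?_
  -- `F × F` carries the sup norm; the orthogonal decomposition takes place in its `ℓ²` version
  let e := WithLp.prodContinuousLinearEquiv 2 ℂ F F
  let K : Submodule ℂ (WithLp 2 (F × F)) := T.graph.topologicalClosure.comap (e : _ →ₗ[ℂ] F × F)
  have hK : IsClosed (K : Set (WithLp 2 (F × F))) :=
    (T.graph.isClosed_topologicalClosure).preimage e.continuous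
  have : CompleteSpace K := hK.completeSpace_coe
  obtain ⟨k, hk, r, hr, hkr⟩ := K.exists_add_mem_mem_orthogonal (e.symm z)
  have hz' : z = e k + e r := by rw [← map_add, ← hkr, e.apply_symm_apply]
  have hk' : e k ∈ T.graph.topologicalClosure := hk
  have hr' : e r ∈ T.graph.adjoint := by
    have : e r = z - e k := by rw [hz']; abel
    rw [this]
    exact Submodule.sub_mem _ hz (hle hk')
  have h1 : ∀ y : T.domain, inner ℂ (T y) r.fst = inner ℂ (y : F) r.snd :=
    mem_graph_adjoint_iff.1 hr'
  have h2 : ∀ y : T.domain, inner ℂ (y : F) r.fst + inner ℂ (T y) r.snd = 0 := fun y => by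
    have := (K.mem_orthogonal r).1 hr (e.symm (y, T y)) (by
      change e (e.symm _) ∈ T.graph.topologicalClosure
      rw [e.apply_symm_apply]
      exact T.graph.le_topologicalClosure (T.mem_graph y))
    rw [WithLp.prod_inner_apply] at this
    exact this
  have hs : r.snd + Complex.I • r.fst = 0 := hdef Complex.I (by simp) _ fun y => by
    simp only [inner_add_right, inner_smul_right, smul_add, smul_smul, Complex.I_mul_I]
    rw [h1 y]
    linear_combination h2 y
  have hsnd : r.snd = (-Complex.I) • r.fst := by
    rw [neg_smul]
    exact eq_neg_of_add_eq_zero_left hs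
  have hfst : r.fst = 0 := hdef (-Complex.I) (by simp) _ fun y => by rw [h1 y, hsnd]
  have hr0 : e r = 0 := Prod.ext hfst (by
    change r.snd = 0
    rw [hsnd, hfst, smul_zero])
  rw [hz', hr0, add_zero]
  exact hk'

/-- A densely defined symmetric operator without deficiency vectors is closable and its closure is
self-adjoint. -/
theorem isSelfAdjoint_closure_of_deficiency {T : F →ₗ.[ℂ] F} (hd : Dense (T.domain : Set F))
    (hT : T.IsFormalAdjoint T)
    (hdef : ∀ z : ℂ, z.im ≠ 0 → ∀ x : F,
      (∀ y : T.domain, inner ℂ (T y) x = inner ℂ (y : F) (z • x)) → x = 0) :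
    T.IsClosable ∧ IsSelfAdjoint T.closure := by
  have hg := graph_adjoint_eq_topologicalClosure hd hT hdef
  have hc : T.IsClosable := ⟨_, hg.trans (LinearPMap.adjoint_graph_eq_graph_adjoint hd).symm⟩
  have hS : T.closure.graph = T.graph.adjoint := hc.graph_closure_eq_closure_graph.symm.trans hg
  have hdS : Dense (T.closure.domain : Set F) := hd.mono T.le_closure.1
  refine ⟨hc, ?_⟩
  rw [LinearPMap.isSelfAdjoint_def]
  refine LinearPMap.eq_of_eq_graph ?_
  rw [LinearPMap.adjoint_graph_eq_graph_adjoint hdS, ← hc.graph_closure_eq_closure_graph,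
    adjoint_topologicalClosure, hg]

end Criterion

/-! ### Measurability and local integrability of the potential -/

section Potential

variable {d n m : ℕ} {V : Space d → ℝ}

lemma quasiMeasurePreserving_nucleon (d n m : ℕ) (j : Fin n) :
    Measure.QuasiMeasurePreserving (fun p : Config d n m => p.1 j) volume volume :=
  (Measure.quasiMeasurePreserving_eval (fun _ : Fin n => (volume : Measure (Space d))) j).comp
    Measure.quasiMeasurePreserving_fst

lemma continuous_omega (m₀ : ℝ) : Continuous (omega m₀ : Space d → ℝ) := by
  unfold omega
  fun_prop

lemma potential_nonneg_ae (m₀ : ℝ) (hV : ∀ᵐ x, 0 ≤ V x) :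
    ∀ᵐ p : Config d n m, 0 ≤ potential m₀ V p := by
  have h : ∀ j : Fin n, ∀ᵐ p : Config d n m, 0 ≤ V (p.1 j) := fun j =>
    (quasiMeasurePreserving_nucleon d n m j).ae hV
  filter_upwards [ae_all_iff.2 h] with p hp
  exact add_nonneg (Finset.sum_nonneg fun j _ => hp j)
    (Finset.sum_nonneg fun l _ => Real.sqrt_nonneg _)

lemma locallyIntegrable_of_memLp_two_restrict
    (hV : ∀ K : Set (Space d), IsCompact K → MemLp V 2 (volume.restrict K)) :
    LocallyIntegrable V :=
  locallyIntegrable_iff.2 fun K hK => by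
    have : IsFiniteMeasure ((volume : Measure (Space d)).restrict K) :=
      ⟨by simpa using hK.measure_lt_top⟩
    exact (hV K hK).integrable one_le_two

lemma locallyIntegrable_comp_nucleon (hV : LocallyIntegrable V) (j : Fin n) :
    LocallyIntegrable (fun p : Config d n m => V (p.1 j)) := by
  refine locallyIntegrable_iff.2 fun K hK => ?_
  obtain ⟨R, hR⟩ := hK.isBounded.subset_closedBall 0
  by_cases hR0 : R < 0
  · rw [Metric.closedBall_eq_empty.2 hR0] at hR
    rw [Set.subset_empty_iff.1 hR]
    exact integrableOn_empty
  push Not at hR0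
  refine IntegrableOn.mono_set ?_ hR
  rw [show (0 : Config d n m) = (0, 0) from rfl, ← closedBall_prod_same, closedBall_pi _ hR0,
    closedBall_pi _ hR0, IntegrableOn, Measure.volume_eq_prod, ← Measure.prod_restrict]
  rw [volume_pi, volume_pi, Measure.restrict_pi_pi, Measure.restrict_pi_pi]
  have : IsFiniteMeasure ((volume : Measure (Space d)).restrict (Metric.closedBall 0 R)) :=
    ⟨by simpa using (isCompact_closedBall (0 : Space d) R).measure_lt_top⟩
  refine Integrable.comp_fst (f := fun x : Fin n → Space d => V (x j)) ?_ _
  exact integrable_comp_eval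
    (μ := fun _ : Fin n => (volume : Measure (Space d)).restrict (Metric.closedBall 0 R))
    (hV.integrableOn_isCompact (isCompact_closedBall (0 : Space d) R))

lemma locallyIntegrable_potential (m₀ : ℝ) (hV : LocallyIntegrable V) :
    LocallyIntegrable (potential m₀ V : Config d n m → ℝ) := by
  have h1 : LocallyIntegrable (fun p : Config d n m => ∑ j, V (p.1 j)) :=
    locallyIntegrable_finsetSum Finset.univ fun j _ => locallyIntegrable_comp_nucleon hV j
  have h2 : Continuous (fun p : Config d n m => ∑ l, omega m₀ (p.2 l)) :=
    continuous_finsetSum _ fun l _ => (continuous_omega m₀).comp (by fun_prop)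
  exact h1.add h2.locallyIntegrable

end Potential

/-! ### Test functions as elements of the form domain -/

section TestFunctions

variable {d n m : ℕ}

lemma memLp_ofReal_of_hasCompactSupport {g : Config d n m → ℝ} (hc : Continuous g)
    (hs : HasCompactSupport g) : MemLp (fun p => (g p : ℂ)) 2 volume :=
  (Complex.continuous_ofReal.comp hc).memLp_of_hasCompactSupport
    (hs.comp_left Complex.ofReal_zero)

/-- A real test function as an element of `L²`. -/
def testVector (g : Config d n m → ℝ) (hc : Continuous g) (hs : HasCompactSupport g) : L2 d n m :=
  (memLp_ofReal_of_hasCompactSupport hc hs).toLp _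

lemma coeFn_testVector {g : Config d n m → ℝ} (hc : Continuous g) (hs : HasCompactSupport g) :
    testVector g hc hs =ᵐ[volume] fun p => (g p : ℂ) :=
  MemLp.coeFn_toLp _

lemma inner_testVector {g : Config d n m → ℝ} (hc : Continuous g) (hs : HasCompactSupport g)
    (u : L2 d n m) : inner ℂ (testVector g hc hs) u = ∫ p, g p • u p := by
  rw [L2.inner_def]
  refine integral_congr_ae ?_
  filter_upwards [coeFn_testVector hc hs] with p hp
  rw [hp]
  simp [mul_comm]

lemma continuous_fderiv_apply {g : Config d n m → ℝ} (hg : ContDiff ℝ ∞ g) (e : Config d n m) :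
    Continuous fun p => fderiv ℝ g p e :=
  (hg.continuous_fderiv (by simp)).clm_apply continuous_const

lemma isWeakGradient_iff {u : L2 d n m} {Du : Fin n → Fin d → L2 d n m} :
    IsWeakGradient u Du ↔ ∀ (j : Fin n) (i : Fin d) (g : Config d n m → ℝ) (hg : ContDiff ℝ ∞ g)
      (hs : HasCompactSupport g),
      inner ℂ (testVector _ (continuous_fderiv_apply hg (nucleonDir d n m j i))
        (hs.fderiv_apply ℝ _)) u + inner ℂ (testVector g hg.continuous hs) (Du j i) = 0 := by
  simp only [inner_testVector, add_eq_zero_iff_eq_neg]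
  rfl

lemma eq_zero_of_inner_testVector {u : L2 d n m}
    (h : ∀ (g : Config d n m → ℝ) (hg : ContDiff ℝ ∞ g) (hs : HasCompactSupport g),
      inner ℂ (testVector g hg.continuous hs) u = 0) : u = 0 := by
  have h0 := ae_eq_zero_of_integral_contDiff_smul_eq_zero
    ((Lp.memLp u).locallyIntegrable one_le_two) fun g hg hs => by
      rw [← inner_testVector hg.continuous hs]
      exact h g hg hs
  exact (Lp.eq_zero_iff_ae_eq_zero).2 h0

lemma IsWeakGradient.eq_zero {Du : Fin n → Fin d → L2 d n m} (h : IsWeakGradient 0 Du) :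
    Du = fun _ _ => 0 := by
  funext j i
  refine eq_zero_of_inner_testVector fun g hg hs => ?_
  simpa using isWeakGradient_iff.1 h j i g hg hs

lemma isAddHaarMeasure_volume_config (d n m : ℕ) :
    (volume : Measure (Config d n m)).IsAddHaarMeasure :=
  Measure.prod.instIsAddHaarMeasure (volume : Measure (Fin n → Space d))
    (volume : Measure (Fin m → Space d))

lemma isWeakGradient_testVector {g : Config d n m → ℝ} (hg : ContDiff ℝ ∞ g)
    (hs : HasCompactSupport g) : IsWeakGradient (testVector g hg.continuous hs) fun j i =>
      testVector _ (continuous_fderiv_apply hg (nucleonDir d n m j i)) (hs.fderiv_apply ℝ _) := by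
  intro j i h hh hhs
  have cg := continuous_fderiv_apply hg (nucleonDir d n m j i)
  have ch := continuous_fderiv_apply hh (nucleonDir d n m j i)
  have e1 : ∫ p, fderiv ℝ h p (nucleonDir d n m j i) • testVector g hg.continuous hs p =
      ((∫ p, fderiv ℝ h p (nucleonDir d n m j i) * g p : ℝ) : ℂ) := by
    rw [← integral_complex_ofReal]
    refine integral_congr_ae ?_
    filter_upwards [coeFn_testVector hg.continuous hs] with p hp
    rw [hp]
    simp
  have e2 : ∫ p, h p • testVector _ cg (hs.fderiv_apply ℝ _) p =
      ((∫ p, h p * fderiv ℝ g p (nucleonDir d n m j i) : ℝ) : ℂ) := by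
    rw [← integral_complex_ofReal]
    refine integral_congr_ae ?_
    filter_upwards [coeFn_testVector cg (hs.fderiv_apply ℝ _)] with p hp
    rw [hp]
    simp
  have := isAddHaarMeasure_volume_config d n m
  rw [e1, e2, integral_mul_fderiv_eq_neg_fderiv_mul_of_integrable
    ((ch.mul hg.continuous).integrable_of_hasCompactSupport hs.mul_left)
    ((hh.continuous.mul cg).integrable_of_hasCompactSupport hhs.mul_right)
    ((hh.continuous.mul hg.continuous).integrable_of_hasCompactSupport hhs.mul_right)
    (fun p _ => (hh.differentiable (by simp)).differentiableAt)
    (fun p _ => (hg.differentiable (by simp)).differentiableAt)]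
  simp

lemma memLp_sqrt_potential_mul {m₀ : ℝ} {V : Space d → ℝ} (hV : LocallyIntegrable V)
    (hV0 : ∀ᵐ x, 0 ≤ V x) {g : Config d n m → ℝ} (hc : Continuous g) (hs : HasCompactSupport g) :
    MemLp (fun p => (Real.sqrt (potential m₀ V p) : ℂ) * testVector g hc hs p) 2
      (volume : Measure (Config d n m)) := by
  have hp := locallyIntegrable_potential (n := n) (m := m) m₀ hV
  have hm : AEStronglyMeasurable
      (fun p => (Real.sqrt (potential m₀ V p) : ℂ) * testVector g hc hs p)
      (volume : Measure (Config d n m)) :=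
    (Complex.continuous_ofReal.comp_aestronglyMeasurable
      (Real.continuous_sqrt.comp_aestronglyMeasurable hp.aestronglyMeasurable)).mul
      (Lp.aestronglyMeasurable _)
  rw [memLp_two_iff_integrable_sq_norm hm]
  have hi : Integrable (fun p => (g p ^ 2) • potential m₀ V p)
      (volume : Measure (Config d n m)) :=
    hp.integrable_smul_left_of_hasCompactSupport (hc.pow 2)
      (hs.comp_left (g := fun x : ℝ => x ^ 2) (by simp))
  refine hi.congr ?_
  filter_upwards [coeFn_testVector hc hs, potential_nonneg_ae m₀ hV0] with p h1 h2
  rw [h1, norm_mul, mul_pow, Complex.norm_real, Complex.norm_real, Real.norm_eq_abs, sq_abs,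
    Real.norm_eq_abs, sq_abs, Real.sq_sqrt h2, smul_eq_mul, mul_comm]

lemma inFormDomain_testVector {m₀ : ℝ} {V : Space d → ℝ} (hV : LocallyIntegrable V)
    (hV0 : ∀ᵐ x, 0 ≤ V x) {g : Config d n m → ℝ} (hg : ContDiff ℝ ∞ g) (hs : HasCompactSupport g) :
    InFormDomain m₀ V (testVector g hg.continuous hs) fun j i =>
      testVector _ (continuous_fderiv_apply hg (nucleonDir d n m j i)) (hs.fderiv_apply ℝ _) :=
  ⟨isWeakGradient_testVector hg hs, memLp_sqrt_potential_mul hV hV0 hg.continuous hs⟩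

lemma contDiff_permute (σ : Equiv.Perm (Fin n)) (τ : Equiv.Perm (Fin m)) :
    ContDiff ℝ ∞ (permute d σ τ) := by
  unfold permute
  refine ContDiff.prodMk (contDiff_pi.2 fun j => ?_) (contDiff_pi.2 fun l => ?_)
  · exact contDiff_pi.1 (contDiff_fst (𝕜 := ℝ) (E := Fin n → Space d) (F := Fin m → Space d))
      (σ j)
  · exact contDiff_pi.1 (contDiff_snd (𝕜 := ℝ) (E := Fin n → Space d) (F := Fin m → Space d))
      (τ l)

lemma permute_permute (σ σ' : Equiv.Perm (Fin n)) (τ τ' : Equiv.Perm (Fin m)) (p : Config d n m) :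
    permute d σ' τ' (permute d σ τ p) = permute d (σ * σ') (τ * τ') p := rfl

lemma hasCompactSupport_comp_permute {g : Config d n m → ℝ} (hs : HasCompactSupport g)
    (σ : Equiv.Perm (Fin n)) (τ : Equiv.Perm (Fin m)) :
    HasCompactSupport (g ∘ permute d σ τ) := by
  let e : Config d n m ≃ₜ Config d n m :=
    { toFun := permute d σ τ
      invFun := permute d σ⁻¹ τ⁻¹
      left_inv := fun p => by rw [permute_permute, mul_inv_cancel, mul_inv_cancel]; rfl
      right_inv := fun p => by rw [permute_permute, inv_mul_cancel, inv_mul_cancel]; rfl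
      continuous_toFun := (contDiff_permute σ τ).continuous
      continuous_invFun := (contDiff_permute σ⁻¹ τ⁻¹).continuous }
  exact hs.comp_homeomorph e

/-- The (unnormalized) symmetrization of a test function. -/
def symmetrize (g : Config d n m → ℝ) (p : Config d n m) : ℝ :=
  ∑ s : Equiv.Perm (Fin n) × Equiv.Perm (Fin m), g (permute d s.1 s.2 p)

lemma contDiff_symmetrize {g : Config d n m → ℝ} (hg : ContDiff ℝ ∞ g) :
    ContDiff ℝ ∞ (symmetrize g) :=
  ContDiff.sum fun s _ => hg.comp (contDiff_permute s.1 s.2)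

lemma hasCompactSupport_symmetrize {g : Config d n m → ℝ} (hs : HasCompactSupport g) :
    HasCompactSupport (symmetrize g) := by
  have : ∀ S : Finset (Equiv.Perm (Fin n) × Equiv.Perm (Fin m)),
      HasCompactSupport fun p => ∑ s ∈ S, g (permute d s.1 s.2 p) := by
    classical
    intro S
    induction S using Finset.induction_on with
    | empty =>
      simp only [Finset.sum_empty]
      exact HasCompactSupport.zero
    | insert s S hsS ih =>
      simp only [Finset.sum_insert hsS]
      exact (hasCompactSupport_comp_permute hs s.1 s.2).add ih
  exact this Finset.univ

lemma symmetrize_permute (g : Config d n m → ℝ) (σ : Equiv.Perm (Fin n)) (τ : Equiv.Perm (Fin m))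
    (p : Config d n m) : symmetrize g (permute d σ τ p) = symmetrize g p := by
  unfold symmetrize
  simp only [permute_permute]
  exact Equiv.sum_comp (Equiv.mulLeft ((σ, τ) : Equiv.Perm (Fin n) × Equiv.Perm (Fin m)))
    fun s => g (permute d s.1 s.2 p)

lemma testVector_symmetrize_mem_sector {g : Config d n m → ℝ} (hg : ContDiff ℝ ∞ g)
    (hs : HasCompactSupport g) :
    testVector (symmetrize g) (contDiff_symmetrize hg).continuous
      (hasCompactSupport_symmetrize hs) ∈ sector d n m := by
  intro σ τ
  unfold testVector
  rw [Lp.toLp_compMeasurePreserving, MemLp.toLp_eq_toLp_iff]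
  exact Filter.Eventually.of_forall fun p => by
    simp only [Function.comp_apply, symmetrize_permute]

/-- Against a symmetric function, a test function and its symmetrization have the same integral, up
to the number of permutations. -/
lemma inner_testVector_symmetrize {g : Config d n m → ℝ} (hg : ContDiff ℝ ∞ g)
    (hs : HasCompactSupport g) {w : L2 d n m} (hw : w ∈ sector d n m) :
    inner ℂ (testVector (symmetrize g) (contDiff_symmetrize hg).continuous
      (hasCompactSupport_symmetrize hs)) w =
      (Fintype.card (Equiv.Perm (Fin n) × Equiv.Perm (Fin m)) : ℂ) *
        inner ℂ (testVector g hg.continuous hs) w := by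
  have hperm : ∀ s : Equiv.Perm (Fin n) × Equiv.Perm (Fin m),
      ∫ p, g (permute d s.1 s.2 p) • w p = ∫ p, g p • w p := by
    intro s
    have hmp := measurePreserving_permute d s.1 s.2
    have h1 : (fun p => g (permute d s.1 s.2 p) • w p) =ᵐ[volume]
        fun p => g (permute d s.1 s.2 p) • w (permute d s.1 s.2 p) := by
      have h2 := Lp.coeFn_compMeasurePreserving w hmp
      rw [hw s.1 s.2] at h2
      filter_upwards [h2] with p hp
      rw [hp]
      rfl
    have h3 := integral_map (μ := volume) (f := fun p => g p • w p) hmp.measurable.aemeasurable (by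
      rw [hmp.map_eq]
      exact hg.continuous.aestronglyMeasurable.smul (Lp.aestronglyMeasurable w))
    rw [hmp.map_eq] at h3
    rw [integral_congr_ae h1, h3]
  rw [inner_testVector, inner_testVector]
  simp only [symmetrize, Finset.sum_smul]
  rw [integral_finsetSum]
  · rw [Finset.sum_congr rfl fun s _ => hperm s]
    simp
  · exact fun s _ => integrable_test_smul
      (hg.continuous.comp (contDiff_permute s.1 s.2).continuous)
      (hasCompactSupport_comp_permute hs s.1 s.2) w

end TestFunctions

/-! ### The form domain as a Hilbert space, and the free Hamiltonian on a sector -/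

/-- Multiplication by a fixed function is a closed operator in `L²`, as `L²` limits hold almost
everywhere along a subsequence; the function need not be measurable. -/
lemma isClosed_setOf_ae_eq_mul {α : Type*} [MeasurableSpace α] {μ : Measure α} (c : α → ℂ) :
    IsClosed {z : Lp ℂ 2 μ × Lp ℂ 2 μ | ∀ᵐ p ∂μ, z.2 p = c p * z.1 p} := by
  refine isClosed_of_closure_subset fun z hz => ?_
  obtain ⟨a, ha, hlim⟩ := mem_closure_iff_seq_limit.1 hz
  have h1 := tendstoInMeasure_of_tendsto_Lp ((continuous_fst.tendsto z).comp hlim)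
  obtain ⟨r, hr, hr'⟩ := h1.exists_seq_tendsto_ae
  have h2 := tendstoInMeasure_of_tendsto_Lp
    (((continuous_snd.tendsto z).comp hlim).comp hr.tendsto_atTop)
  obtain ⟨t, ht, ht'⟩ := h2.exists_seq_tendsto_ae
  have h3 : ∀ᵐ p ∂μ, ∀ k, (a k).2 p = c p * (a k).1 p := ae_all_iff.2 ha
  filter_upwards [hr', ht', h3] with p p1 p2 p3
  refine tendsto_nhds_unique p2 (((p1.comp ht.tendsto_atTop).const_mul (c p)).congr fun k => ?_)
  exact (p3 _).symm

section Form

variable {d n m : ℕ}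

/-- The Hilbert space of triples `(u, s, D)` with `u, s ∈ L²` and one `D j i ∈ L²` for each
coordinate of a nucleon. The form domain of `H₀` is embedded into it by
`u ↦ (u, √ε √W u, √(ε/(2M)) ∇u)`, where `W` is the potential. The index `none` stands for `u`,
`some none` for `s`, and `some (some (j, i))` for `D j i`. -/
abbrev FormSpace (d n m : ℕ) : Type :=
  PiLp 2 fun _ : Option (Option (Fin n × Fin d)) => L2 d n m

/-- The image of the symmetric part of the form domain of `H₀` in `FormSpace`. -/
def formSubspace (d n m : ℕ) (ε M m₀ : ℝ) (V : Space d → ℝ) : Submodule ℂ (FormSpace d n m) where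
  carrier := {U | U none ∈ sector d n m ∧
    (∀ᵐ p, U (some none) p =
      ((Real.sqrt ε : ℝ) * (Real.sqrt (potential m₀ V p) : ℝ) : ℂ) * U none p) ∧
    IsWeakGradient ((Real.sqrt (ε / (2 * M)) : ℂ) • U none) fun j i => U (some (some (j, i)))}
  add_mem' := by
    rintro U U' ⟨h1, h2, h3⟩ ⟨h1', h2', h3'⟩
    refine ⟨add_mem h1 h1', ?_, ?_⟩
    · filter_upwards [h2, h2', Lp.coeFn_add (U (some none)) (U' (some none)),
        Lp.coeFn_add (U none) (U' none)] with p p1 p2 p3 p4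
      rw [PiLp.add_apply, PiLp.add_apply, p3, p4, Pi.add_apply, Pi.add_apply, p1, p2, mul_add]
    · rw [isWeakGradient_iff] at h3 h3' ⊢
      intro j i g hg hs
      have e1 := h3 j i g hg hs
      have e2 := h3' j i g hg hs
      simp only [PiLp.add_apply, smul_add, inner_add_right]
      linear_combination e1 + e2
  zero_mem' := by
    refine ⟨zero_mem _, ?_, ?_⟩
    · filter_upwards [Lp.coeFn_zero ℂ 2 (volume : Measure (Config d n m))] with p hp
      rw [PiLp.zero_apply, PiLp.zero_apply, hp, Pi.zero_apply, mul_zero]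
    · rw [isWeakGradient_iff]
      simp
  smul_mem' := by
    rintro c U ⟨h1, h2, h3⟩
    refine ⟨Submodule.smul_mem _ _ h1, ?_, ?_⟩
    · filter_upwards [h2, Lp.coeFn_smul c (U (some none)), Lp.coeFn_smul c (U none)]
        with p p1 p2 p3
      rw [PiLp.smul_apply, PiLp.smul_apply, p2, p3, Pi.smul_apply, Pi.smul_apply, p1]
      simp only [smul_eq_mul]
      ring
    · rw [isWeakGradient_iff] at h3 ⊢
      intro j i g hg hs
      have e1 := h3 j i g hg hs
      simp only [PiLp.smul_apply, smul_comm _ c, inner_smul_right] at e1 ⊢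
      linear_combination c * e1

lemma isClosed_formSubspace (ε M m₀ : ℝ) (V : Space d → ℝ) :
    IsClosed (formSubspace d n m ε M m₀ V : Set (FormSpace d n m)) := by
  have h1 : IsClosed {U : FormSpace d n m | U none ∈ sector d n m} :=
    (isClosed_sector d n m).preimage (PiLp.continuous_apply 2 _ none)
  have h2 : IsClosed {U : FormSpace d n m | ∀ᵐ p, U (some none) p =
      ((Real.sqrt ε : ℝ) * (Real.sqrt (potential m₀ V p) : ℝ) : ℂ) * U none p} := by
    have h := isClosed_setOf_ae_eq_mul (μ := (volume : Measure (Config d n m)))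
      fun p => ((Real.sqrt ε : ℝ) * (Real.sqrt (potential m₀ V p) : ℝ) : ℂ)
    exact h.preimage ((PiLp.continuous_apply 2 (fun _ => L2 d n m) none).prodMk
      (PiLp.continuous_apply 2 (fun _ => L2 d n m)
        (some none : Option (Option (Fin n × Fin d)))))
  have h3 : IsClosed {U : FormSpace d n m |
      IsWeakGradient ((Real.sqrt (ε / (2 * M)) : ℂ) • U none)
        fun j i => U (some (some (j, i)))} := by
    simp only [isWeakGradient_iff, Set.ofPred_forall]
    refine isClosed_iInter fun j => isClosed_iInter fun i => isClosed_iInter fun g =>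
      isClosed_iInter fun hg => isClosed_iInter fun hs => isClosed_eq ?_ continuous_const
    have hc : Continuous fun U : FormSpace d n m => (Real.sqrt (ε / (2 * M)) : ℂ) • U none :=
      (continuous_const_smul _).comp (PiLp.continuous_apply 2 _ none)
    exact (continuous_const.inner hc).add (continuous_const.inner (PiLp.continuous_apply 2 _ _))
  exact h1.inter (h2.inter h3)

lemma IsWeakGradient.const_smul {u : L2 d n m} {Du : Fin n → Fin d → L2 d n m}
    (h : IsWeakGradient u Du) (c : ℂ) : IsWeakGradient (c • u) fun j i => c • Du j i := by
  rw [isWeakGradient_iff] at h ⊢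
  intro j i g hg hs
  simp only [inner_smul_right]
  linear_combination c * h j i g hg hs

/-- The embedding of the form domain into `FormSpace`. -/
def formEmbed (ε M : ℝ) {m₀ : ℝ} {V : Space d → ℝ} {u : L2 d n m}
    {Du : Fin n → Fin d → L2 d n m} (h : InFormDomain m₀ V u Du) : FormSpace d n m :=
  WithLp.toLp 2 fun
    | none => u
    | some none => (Real.sqrt ε : ℂ) • h.2.toLp _
    | some (some (j, i)) => (Real.sqrt (ε / (2 * M)) : ℂ) • Du j i

lemma formEmbed_mem {ε M m₀ : ℝ} {V : Space d → ℝ} {u : L2 d n m}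
    {Du : Fin n → Fin d → L2 d n m} (h : InFormDomain m₀ V u Du) (hu : u ∈ sector d n m) :
    formEmbed ε M h ∈ formSubspace d n m ε M m₀ V := by
  refine ⟨hu, ?_, h.1.const_smul _⟩
  change ∀ᵐ p, ((Real.sqrt ε : ℂ) • h.2.toLp _ : L2 d n m) p = _ * u p
  filter_upwards [Lp.coeFn_smul (Real.sqrt ε : ℂ) (h.2.toLp _), h.2.coeFn_toLp] with p h1 h2
  rw [h1, Pi.smul_apply, h2, smul_eq_mul, mul_assoc]

/-- Every element of `formSubspace` comes from the form domain. -/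
lemma exists_formEmbed_eq {ε M m₀ : ℝ} (hε : 0 < ε) (hM : 0 < M) {V : Space d → ℝ}
    {U : FormSpace d n m} (hU : U ∈ formSubspace d n m ε M m₀ V) :
    ∃ (Du : Fin n → Fin d → L2 d n m) (h : InFormDomain m₀ V (U none) Du),
      U = formEmbed ε M h := by
  obtain ⟨-, h2, h3⟩ := hU
  have hε' : (Real.sqrt ε : ℂ) ≠ 0 := by
    exact_mod_cast (Real.sqrt_pos.2 hε).ne'
  have hM' : (Real.sqrt (ε / (2 * M)) : ℂ) ≠ 0 := by
    exact_mod_cast (Real.sqrt_pos.2 (by positivity)).ne'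
  have hw : IsWeakGradient (U none)
      fun j i => (Real.sqrt (ε / (2 * M)) : ℂ)⁻¹ • U (some (some (j, i))) := by
    have := h3.const_smul (Real.sqrt (ε / (2 * M)) : ℂ)⁻¹
    rwa [smul_smul, inv_mul_cancel₀ hM', one_smul] at this
  have hp : (fun p => (Real.sqrt (potential m₀ V p) : ℂ) * U none p) =ᵐ[volume]
      ((Real.sqrt ε : ℂ)⁻¹ • U (some none) : L2 d n m) := by
    filter_upwards [h2, Lp.coeFn_smul (Real.sqrt ε : ℂ)⁻¹ (U (some none))] with p p1 p2
    rw [p2, Pi.smul_apply, p1, smul_eq_mul]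
    field_simp
  have hmem : InFormDomain m₀ V (U none)
      fun j i => (Real.sqrt (ε / (2 * M)) : ℂ)⁻¹ • U (some (some (j, i))) :=
    ⟨hw, (memLp_congr_ae hp).2 (Lp.memLp _)⟩
  refine ⟨_, hmem, ?_⟩
  ext1 k
  rcases k with _ | _ | ⟨j, i⟩
  · rfl
  · change U (some none) = (Real.sqrt ε : ℂ) • hmem.2.toLp _
    have : hmem.2.toLp _ = (Real.sqrt ε : ℂ)⁻¹ • U (some none) :=
      Lp.ext (hmem.2.coeFn_toLp.trans hp)
    rw [this, smul_smul, mul_inv_cancel₀ hε', one_smul]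
  · change U (some (some (j, i))) = (Real.sqrt (ε / (2 * M)) : ℂ) •
      ((Real.sqrt (ε / (2 * M)) : ℂ)⁻¹ • U (some (some (j, i))))
    rw [smul_smul, mul_inv_cancel₀ hM', one_smul]

lemma inner_sqrt_smul {E : Type*} [NormedAddCommGroup E] [InnerProductSpace ℂ E] {c : ℝ}
    (hc : 0 ≤ c) (x y : E) :
    inner ℂ ((Real.sqrt c : ℂ) • x) ((Real.sqrt c : ℂ) • y) = (c : ℂ) * inner ℂ x y := by
  rw [inner_smul_left, inner_smul_right, Complex.conj_ofReal, ← mul_assoc, ← Complex.ofReal_mul,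
    Real.mul_self_sqrt hc]

/-- The inner product of `FormSpace` restricts to `⟨v, u⟩ + q(v, u)` on the form domain. -/
lemma inner_formEmbed {ε M m₀ : ℝ} (hε : 0 < ε) (hM : 0 < M) {V : Space d → ℝ}
    {v u : L2 d n m} {Dv Du : Fin n → Fin d → L2 d n m} (hv : InFormDomain m₀ V v Dv)
    (hu : InFormDomain m₀ V u Du) :
    inner ℂ (formEmbed ε M hv) (formEmbed ε M hu) =
      inner ℂ v u + freeForm ε M m₀ V v Dv u Du := by
  have h1 : inner ℂ (hv.2.toLp _) (hu.2.toLp _) =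
      ∫ p : Config d n m, inner ℂ ((Real.sqrt (potential m₀ V p) : ℂ) * v p)
        ((Real.sqrt (potential m₀ V p) : ℂ) * u p) := by
    rw [L2.inner_def]
    refine integral_congr_ae ?_
    filter_upwards [hv.2.coeFn_toLp, hu.2.coeFn_toLp] with p p1 p2
    rw [p1, p2]
  rw [PiLp.inner_apply, Fintype.sum_option, Fintype.sum_option, Fintype.sum_prod_type]
  change inner ℂ v u + (inner ℂ ((Real.sqrt ε : ℂ) • hv.2.toLp _)
    ((Real.sqrt ε : ℂ) • hu.2.toLp _) + ∑ j, ∑ i,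
      inner ℂ ((Real.sqrt (ε / (2 * M)) : ℂ) • Dv j i) ((Real.sqrt (ε / (2 * M)) : ℂ) • Du j i)) = _
  simp only [inner_sqrt_smul hε.le, inner_sqrt_smul (show 0 ≤ ε / (2 * M) by positivity), h1,
    ← Finset.mul_sum]
  unfold freeForm
  push_cast
  ring

/-- The form of `H₀` is represented on the sector by an operator `H₀` with `H₀ + 1` onto, by the
Riesz representation theorem in the form domain. -/
lemma exists_mem_freeSectorGraph {ε M : ℝ} (hε : 0 < ε) (hM : 0 < M) (m₀ : ℝ) (V : Space d → ℝ)
    (h : sector d n m) : ∃ u : sector d n m, (u, h - u) ∈ freeSectorGraph d n m ε M m₀ V := by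
  have : CompleteSpace (formSubspace d n m ε M m₀ V) :=
    (isClosed_formSubspace ε M m₀ V).completeSpace_coe
  let ℓ : StrongDual ℂ (formSubspace d n m ε M m₀ V) :=
    innerSL ℂ (h : L2 d n m) ∘L
      (PiLp.proj (𝕜 := ℂ) 2 (fun _ : Option (Option (Fin n × Fin d)) => L2 d n m) none) ∘L
      (formSubspace d n m ε M m₀ V).subtypeL
  let X := (InnerProductSpace.toDual ℂ (formSubspace d n m ε M m₀ V)).symm ℓ
  have hX : ∀ U : formSubspace d n m ε M m₀ V,
      inner ℂ (X : FormSpace d n m) (U : FormSpace d n m) =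
        inner ℂ (h : L2 d n m) ((U : FormSpace d n m) none) := fun U =>
    InnerProductSpace.toDual_symm_apply (𝕜 := ℂ) (x := U) (y := ℓ)
  obtain ⟨Du, hu, hXu⟩ := exists_formEmbed_eq hε hM X.2
  refine ⟨⟨(X : FormSpace d n m) none, X.2.1⟩, Du, hu, fun v Dv hv => ?_⟩
  have h1 := hX ⟨_, formEmbed_mem (ε := ε) (M := M) hv v.2⟩
  have h2 := congrArg (starRingEnd ℂ) h1
  rw [inner_conj_symm, inner_conj_symm] at h2
  change inner ℂ (formEmbed ε M hv) (X : FormSpace d n m) = inner ℂ (v : L2 d n m) h at h2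
  rw [hXu, inner_formEmbed hε hM] at h2
  rw [inner_sub_right]
  exact eq_sub_of_add_eq' h2

lemma freeForm_conj_symm (ε M m₀ : ℝ) (V : Space d → ℝ) (v u : L2 d n m)
    (Dv Du : Fin n → Fin d → L2 d n m) :
    starRingEnd ℂ (freeForm ε M m₀ V v Dv u Du) = freeForm ε M m₀ V u Du v Dv := by
  unfold freeForm
  simp only [map_mul, map_add, map_sum, inner_conj_symm, Complex.conj_ofReal, ← integral_conj]

/-- `H₀` is symmetric on each sector. -/
lemma inner_freeSectorGraph {ε M m₀ : ℝ} {V : Space d → ℝ} {u w u' w' : sector d n m}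
    (h : (u, w) ∈ freeSectorGraph d n m ε M m₀ V) (h' : (u', w') ∈ freeSectorGraph d n m ε M m₀ V) :
    inner ℂ w u' = inner ℂ u w' := by
  obtain ⟨Du, hu, h⟩ := h
  obtain ⟨Du', hu', h'⟩ := h'
  have e1 := h u' Du' hu'
  have e2 := h' u Du hu
  rw [← inner_conj_symm (𝕜 := ℂ) w u', ← e2, ← freeForm_conj_symm]
  exact congrArg (starRingEnd ℂ) e1.symm

/-- `H₀` is single-valued on each sector, since the symmetric test functions lie in the form domain
and are total. -/
lemma eq_zero_of_mem_freeSectorGraph {ε M m₀ : ℝ} {V : Space d → ℝ} (hV : LocallyIntegrable V)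
    (hV0 : ∀ᵐ x, 0 ≤ V x) {w : sector d n m} (h : (0, w) ∈ freeSectorGraph d n m ε M m₀ V) :
    w = 0 := by
  obtain ⟨Du, hu, h⟩ := h
  have hDu : Du = fun _ _ => 0 := IsWeakGradient.eq_zero hu.1
  subst hDu
  refine Subtype.ext (eq_zero_of_inner_testVector fun g hg hs => ?_)
  have h1 := h ⟨_, testVector_symmetrize_mem_sector hg hs⟩ _
    (inFormDomain_testVector hV hV0 (contDiff_symmetrize hg) (hasCompactSupport_symmetrize hs))
  have h2 := (freeForm_zero (ε := ε) (M := M) (m₀ := m₀) (V := V) _ _).symm.trans h1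
  have h3 := (inner_testVector_symmetrize hg hs w.2).symm.trans h2.symm
  exact (mul_eq_zero.1 h3).resolve_left (by exact_mod_cast Fintype.card_ne_zero)

/-- `H₀` is self-adjoint on each sector: its graph contains the graph of its adjoint. -/
lemma mem_freeSectorGraph_of_forall {ε M : ℝ} (hε : 0 < ε) (hM : 0 < M) {m₀ : ℝ} {V : Space d → ℝ}
    {x y : sector d n m}
    (h : ∀ u w : sector d n m, (u, w) ∈ freeSectorGraph d n m ε M m₀ V →
      inner ℂ w x = inner ℂ u y) :
    (x, y) ∈ freeSectorGraph d n m ε M m₀ V := by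
  obtain ⟨u₀, hu₀⟩ := exists_mem_freeSectorGraph hε hM m₀ V (x + y)
  -- `x - u₀` is orthogonal to the range of `H₀ + 1`, which is everything
  have hx : x = u₀ := by
    obtain ⟨u, hu⟩ := exists_mem_freeSectorGraph hε hM m₀ V (x - u₀)
    have e1 := h _ _ hu
    have e2 := inner_freeSectorGraph hu hu₀
    refine sub_eq_zero.1 (inner_self_eq_zero (𝕜 := ℂ).1 ?_)
    simp only [inner_sub_left, inner_sub_right, inner_add_right] at e1 e2 ⊢
    linear_combination e1 - e2
  subst hx
  simpa using hu₀

/-- A vector orthogonal to the domain of `H₀` on a sector vanishes. -/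
lemma eq_zero_of_inner_freeSectorGraph {ε M : ℝ} (hε : 0 < ε) (hM : 0 < M) {m₀ : ℝ}
    {V : Space d → ℝ} (hV : LocallyIntegrable V) (hV0 : ∀ᵐ x, 0 ≤ V x) {y : sector d n m}
    (h : ∀ u w : sector d n m, (u, w) ∈ freeSectorGraph d n m ε M m₀ V → inner ℂ u y = 0) :
    y = 0 :=
  eq_zero_of_mem_freeSectorGraph hV hV0 (mem_freeSectorGraph_of_forall hε hM fun u w huw => by
    rw [inner_zero_right, h u w huw])

end Form

/-! ### The interaction on finite particle vectors -/

section Interaction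

variable {d : ℕ} {f : Space d → ℂ}

lemma norm_raise_le (n m : ℕ) (hf : MemLp f 2 volume) :
    ‖raise n m hf‖ ≤ n * (eLpNorm f 2 volume).toReal :=
  LinearMap.mkContinuous_norm_le _ (by positivity) _

lemma norm_creation_apply_le {ε : ℝ} (hε : 0 ≤ ε) (n m : ℕ) (hf : MemLp f 2 volume)
    (u : sector d n m) :
    ‖creation n m ε hf u‖ ≤
      Real.sqrt ε * (n * (eLpNorm f 2 volume).toReal) * Real.sqrt (m + 1) * ‖u‖ := by
  have h1 : ‖creation n m ε hf u‖ = Real.sqrt (ε * (m + 1)) *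
      ‖(sector d n (m + 1)).orthogonalProjectionOnto (raise n m hf (u : L2 d n m))‖ := by
    unfold creation
    rw [smul_apply, norm_smul, Complex.norm_real, Real.norm_eq_abs,
      abs_of_nonneg (Real.sqrt_nonneg _)]
    rfl
  have h2 : ‖raise n m hf (u : L2 d n m)‖ ≤ n * (eLpNorm f 2 volume).toReal * ‖u‖ :=
    (raise n m hf).le_of_opNorm_le (norm_raise_le n m hf) _
  rw [h1, Real.sqrt_mul hε]
  calc Real.sqrt ε * Real.sqrt (m + 1) *
        ‖(sector d n (m + 1)).orthogonalProjectionOnto (raise n m hf (u : L2 d n m))‖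
      ≤ Real.sqrt ε * Real.sqrt (m + 1) * (n * (eLpNorm f 2 volume).toReal * ‖u‖) := by
        gcongr
        exact (Submodule.norm_orthogonalProjectionOnto_apply_le _ _).trans h2
    _ = _ := by ring

/-- The vector with a single nonzero component `u`, on the sector with `n` nucleons and `m`
mesons. -/
abbrev sectorVector {n m : ℕ} (u : sector d n m) : Fock d :=
  lp.single (E := fun N : ℕ × ℕ => sector d N.1 N.2) 2 (n, m) u

lemma sectorVector_apply_self {n m : ℕ} (u : sector d n m) : sectorVector u (n, m) = u :=
  lp.single_apply_self (E := fun N : ℕ × ℕ => sector d N.1 N.2) 2 (n, m) u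

lemma sectorVector_apply_ne {n m : ℕ} (u : sector d n m) {N : ℕ × ℕ} (h : N ≠ (n, m)) :
    sectorVector u N = 0 :=
  lp.single_apply_ne (E := fun N : ℕ × ℕ => sector d N.1 N.2) 2 (n, m) u h

/-- `H_I` on a vector with `n` nucleons and `m` mesons. -/
def interactionVector (ε : ℝ) (hf : MemLp f 2 volume) {n : ℕ} : {m : ℕ} → sector d n m → Fock d
  | 0, u => sectorVector ((ε : ℂ) • creation n 0 ε hf u)
  | m + 1, u => sectorVector ((ε : ℂ) • creation n (m + 1) ε hf u) +
      sectorVector ((ε : ℂ) • annihilation n m ε hf u)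

lemma interactionComponent_sectorVector (ε : ℝ) (hf : MemLp f 2 volume) {n m : ℕ}
    (u : sector d n m) :
    interactionComponent ε hf (sectorVector u) = interactionVector ε hf u := by
  funext ⟨n', m'⟩
  by_cases hn : n' = n
  · subst hn
    have key : ∀ k l : ℕ, l ≠ k → ∀ v : sector d n' k, sectorVector v (n', l) = 0 :=
      fun k l h v => sectorVector_apply_ne v (by simpa using h)
    rcases m' with _ | m' <;> rcases m with _ | m
    · simp only [interactionComponent, interactionVector]
      rw [key 0 1 (by simp), key 1 0 (by simp), map_zero, smul_zero]
    · simp only [interactionComponent, interactionVector, lp.coeFn_add, Pi.add_apply]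
      rw [key (m + 1 + 1) 0 (by simp)]
      refine Eq.trans ?_ (zero_add _).symm
      rcases m with _ | m
      · rw [sectorVector_apply_self, sectorVector_apply_self]
      · rw [key _ _ (by omega), key _ _ (by omega), map_zero, smul_zero]
    · simp only [interactionComponent, interactionVector]
      rw [key 0 (m' + 2) (by simp), map_zero, add_zero]
      rcases m' with _ | m'
      · rw [sectorVector_apply_self, sectorVector_apply_self]
      · rw [key _ _ (by omega), key _ _ (by omega), map_zero, smul_zero]
    · simp only [interactionComponent, interactionVector, lp.coeFn_add, Pi.add_apply, smul_add]
      congr 1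
      · by_cases h : m' = m + 1
        · subst h
          rw [sectorVector_apply_self, sectorVector_apply_self]
        · rw [key _ _ h, key _ _ (by omega), map_zero, smul_zero]
      · by_cases h : m' + 1 = m
        · subst h
          rw [sectorVector_apply_self, sectorVector_apply_self]
        · rw [key _ _ (by omega), key _ _ h, map_zero, smul_zero]
  · have key : ∀ k l : ℕ, ∀ v : sector d n k, sectorVector v (n', l) = 0 :=
      fun k l v => sectorVector_apply_ne v (by simp [hn])
    rcases m' with _ | m' <;> rcases m with _ | m <;>
      simp only [interactionComponent, interactionVector, lp.coeFn_add, Pi.add_apply, key, map_zero,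
        smul_zero, add_zero]

lemma inner_sectorVector_left {n m : ℕ} (u : sector d n m) (x : Fock d) :
    inner ℂ (sectorVector u) x = inner ℂ u (x (n, m) : sector d n m) :=
  lp.inner_single_left (𝕜 := ℂ) (G := fun N : ℕ × ℕ => sector d N.1 N.2) (n, m) u x

lemma inner_smul_apply_adjoint {E F : Type*} [NormedAddCommGroup E] [InnerProductSpace ℂ E]
    [CompleteSpace E] [NormedAddCommGroup F] [InnerProductSpace ℂ F] [CompleteSpace F]
    (T : E →L[ℂ] F) (c : ℝ) (v : E) (w : F) :
    inner ℂ ((c : ℂ) • T v) w = inner ℂ v ((c : ℂ) • ContinuousLinearMap.adjoint T w) := by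
  rw [inner_smul_left, inner_smul_right, Complex.conj_ofReal,
    ContinuousLinearMap.adjoint_inner_right]

/-- The creation and annihilation parts of `H_I` are adjoint to each other, componentwise. -/
lemma inner_interactionVector (ε : ℝ) (hf : MemLp f 2 volume) {n m : ℕ} (u : sector d n m)
    (x : Fock d) :
    inner ℂ (interactionVector ε hf u) x = inner ℂ u (interactionComponent ε hf x (n, m)) := by
  have hc : ∀ (k : ℕ) (v : sector d n k) (w : sector d n (k + 1)),
      inner ℂ ((ε : ℂ) • creation n k ε hf v) w =
        inner ℂ v ((ε : ℂ) • annihilation n k ε hf w) :=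
    fun k v w => inner_smul_apply_adjoint (creation n k ε hf) ε v w
  have ha : ∀ (k : ℕ) (v : sector d n (k + 1)) (w : sector d n k),
      inner ℂ ((ε : ℂ) • annihilation n k ε hf v) w =
        inner ℂ v ((ε : ℂ) • creation n k ε hf w) := fun k v w => by
    have h := inner_smul_apply_adjoint (annihilation n k ε hf) ε v w
    rwa [annihilation, ContinuousLinearMap.adjoint_adjoint] at h
  rcases m with _ | m
  · exact (inner_sectorVector_left _ x).trans (hc 0 u (x (n, 1)))
  · have h1 := (inner_sectorVector_left _ x).trans (hc (m + 1) u (x (n, m + 2)))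
    have h2 := (inner_sectorVector_left _ x).trans (ha m u (x (n, m)))
    refine (inner_add_left _ _ _).trans ((congrArg₂ (· + ·) h1 h2).trans ?_)
    exact (inner_add_right u _ _).symm.trans
      (congrArg (inner ℂ u) ((add_comm _ _).trans (smul_add _ _ _).symm))

lemma sectorVector_mem_interaction (ε : ℝ) (hf : MemLp f 2 volume) {n m : ℕ} (u : sector d n m) :
    sectorVector u ∈ (interaction ε hf).domain := by
  change Memℓp (interactionComponent ε hf (sectorVector u)) 2
  rw [interactionComponent_sectorVector]
  exact lp.memℓp _

lemma interaction_sectorVector (ε : ℝ) (hf : MemLp f 2 volume) {n m : ℕ} (u : sector d n m) :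
    interaction ε hf ⟨sectorVector u, sectorVector_mem_interaction ε hf u⟩ =
      interactionVector ε hf u :=
  lp.ext (interactionComponent_sectorVector ε hf u)

/-- The vectors `y` in the domain of `H_I` with `⟨H_I y, x⟩ = ⟨y, H_I x⟩` for every `x` in the
domain of `H_I`. -/
def symmetricPart (ε : ℝ) (hf : MemLp f 2 volume) : Submodule ℂ (Fock d) where
  carrier := {y | ∃ h : y ∈ (interaction ε hf).domain, ∀ x : (interaction ε hf).domain,
    inner ℂ (interaction ε hf ⟨y, h⟩) (x : Fock d) = inner ℂ y (interaction ε hf x)}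
  add_mem' := by
    rintro a b ⟨ha, ha'⟩ ⟨hb, hb'⟩
    refine ⟨add_mem ha hb, fun x => ?_⟩
    rw [inner_add_left, ← ha', ← hb', ← inner_add_left, ← LinearPMap.map_add]
    rfl
  zero_mem' := ⟨zero_mem _, fun x => by
    have : interaction ε hf ⟨0, zero_mem _⟩ = 0 := LinearPMap.map_zero _
    rw [this, inner_zero_left, inner_zero_left]⟩
  smul_mem' := by
    rintro c a ⟨ha, ha'⟩
    refine ⟨Submodule.smul_mem _ c ha, fun x => ?_⟩
    rw [inner_smul_left, ← ha', ← inner_smul_left, ← LinearPMap.map_smul]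
    rfl

lemma sectorVector_mem_symmetricPart (ε : ℝ) (hf : MemLp f 2 volume) {n m : ℕ}
    (u : sector d n m) : sectorVector u ∈ symmetricPart ε hf :=
  ⟨sectorVector_mem_interaction ε hf u, fun x => by
    rw [interaction_sectorVector, inner_interactionVector, inner_sectorVector_left]
    rfl⟩

/-- `H_I` is defined and symmetric on the finite particle vectors. -/
lemma finiteParticle_le_symmetricPart (ε : ℝ) (hf : MemLp f 2 volume) :
    finiteParticle d ≤ symmetricPart ε hf := by
  intro y hy
  have hfin : {N : ℕ × ℕ | y N ≠ 0}.Finite := hy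
  have hsum : y = ∑ N ∈ hfin.toFinset, sectorVector (y N) := by
    refine lp.ext ?_
    funext N
    rw [lp.coeFn_sum, Finset.sum_apply]
    by_cases hN : N ∈ hfin.toFinset
    · rw [Finset.sum_eq_single_of_mem N hN fun N' _ h => sectorVector_apply_ne _ h.symm]
      exact (sectorVector_apply_self (y N)).symm
    · rw [Finset.sum_eq_zero fun N' hN' => sectorVector_apply_ne _ fun h : N = N' =>
        hN (h ▸ hN')]
      simpa using hN
  rw [hsum]
  exact Submodule.sum_mem _ fun N _ => sectorVector_mem_symmetricPart ε hf _

lemma sectorVector_mem_finiteParticle {n m : ℕ} (u : sector d n m) :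
    sectorVector u ∈ finiteParticle d :=
  (Set.finite_singleton (n, m)).subset fun N hN => by
    by_contra h
    exact hN (sectorVector_apply_ne u h)

end Interaction

/-! ### The free Hamiltonian on the Fock space -/

section Free

variable {d : ℕ} {ε M m₀ : ℝ} {V : Space d → ℝ}

lemma mem_graph_freeHamiltonian_iff (hV : LocallyIntegrable V) (hV0 : ∀ᵐ x, 0 ≤ V x)
    {z : Fock d × Fock d} : z ∈ (freeHamiltonian d ε M m₀ V).graph ↔
      ∀ N : ℕ × ℕ, (z.1 N, z.2 N) ∈ freeSectorGraph d N.1 N.2 ε M m₀ V := by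
  unfold freeHamiltonian
  rw [Submodule.toLinearPMap_graph_eq]
  · rfl
  · intro x hx hx0
    refine lp.ext (funext fun N => ?_)
    have h : (x.1 N, x.2 N) ∈ freeSectorGraph d N.1 N.2 ε M m₀ V := hx N
    rw [hx0] at h
    exact eq_zero_of_mem_freeSectorGraph hV hV0 h

lemma freeHamiltonian_apply_mem (hV : LocallyIntegrable V) (hV0 : ∀ᵐ x, 0 ≤ V x)
    (x : (freeHamiltonian d ε M m₀ V).domain) (N : ℕ × ℕ) :
    ((x : Fock d) N, (freeHamiltonian d ε M m₀ V x) N) ∈ freeSectorGraph d N.1 N.2 ε M m₀ V :=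
  (mem_graph_freeHamiltonian_iff hV hV0).1 (LinearPMap.mem_graph _ x) N

lemma sectorVector_mem_graph (hV : LocallyIntegrable V) (hV0 : ∀ᵐ x, 0 ≤ V x) {n m : ℕ}
    {u w : sector d n m} (h : (u, w) ∈ freeSectorGraph d n m ε M m₀ V) :
    (sectorVector u, sectorVector w) ∈ (freeHamiltonian d ε M m₀ V).graph := by
  rw [mem_graph_freeHamiltonian_iff hV hV0]
  intro N
  by_cases hN : N = (n, m)
  · subst hN
    rwa [sectorVector_apply_self, sectorVector_apply_self]
  · rw [sectorVector_apply_ne _ hN, sectorVector_apply_ne _ hN]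
    exact zero_mem _

lemma freeHamiltonian_symmetric (hV : LocallyIntegrable V) (hV0 : ∀ᵐ x, 0 ≤ V x)
    (x y : (freeHamiltonian d ε M m₀ V).domain) :
    inner ℂ (freeHamiltonian d ε M m₀ V x) (y : Fock d) =
      inner ℂ (x : Fock d) (freeHamiltonian d ε M m₀ V y) := by
  rw [lp.inner_eq_tsum, lp.inner_eq_tsum]
  exact tsum_congr fun N => inner_freeSectorGraph (freeHamiltonian_apply_mem hV hV0 x N)
    (freeHamiltonian_apply_mem hV hV0 y N)

lemma dense_domain_inf_finiteParticle (hε : 0 < ε) (hM : 0 < M) (hV : LocallyIntegrable V)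
    (hV0 : ∀ᵐ x, 0 ≤ V x) :
    Dense (((freeHamiltonian d ε M m₀ V).domain ⊓ finiteParticle d : Submodule ℂ (Fock d)) :
      Set (Fock d)) := by
  rw [Submodule.dense_iff_topologicalClosure_eq_top, Submodule.topologicalClosure_eq_top_iff,
    Submodule.eq_bot_iff]
  intro x hx
  refine lp.ext (funext fun ⟨n, m⟩ => ?_)
  refine eq_zero_of_inner_freeSectorGraph (m₀ := m₀) hε hM hV hV0 fun u w huw => ?_
  have h := (Submodule.mem_orthogonal _ x).1 hx (sectorVector u)
    ⟨LinearPMap.mem_domain_of_mem_graph (sectorVector_mem_graph hV hV0 huw),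
      sectorVector_mem_finiteParticle u⟩
  rwa [inner_sectorVector_left] at h

end Free

/-! ### Deficiency vectors along the ladder of meson numbers -/

/-- A divergent series argument of Carleman type: since `∑ 1/√(L+1) = ∞`, a square summable
sequence whose partial sums of squares up to `L` are bounded by `C √(L+1) a_L a_{L+1}` vanishes. -/
lemma eq_zero_of_mul_sum_sq_le {a : ℕ → ℝ} (ha : Summable fun m => a m ^ 2) {C κ : ℝ} (hC : 0 ≤ C)
    (hκ : 0 < κ) (h : ∀ L : ℕ, κ * ∑ m ∈ Finset.range (L + 1), a m ^ 2 ≤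
      C * Real.sqrt (L + 1) * (a L * a (L + 1))) (k : ℕ) : a k = 0 := by
  by_contra hk
  have hδ : 0 < κ * a k ^ 2 := by positivity
  have hs : Summable fun L : ℕ => C * (a L ^ 2 + a (L + 1) ^ 2) :=
    (ha.add ((summable_nat_add_iff 1).2 ha)).mul_left C
  have hle : ∀ L : ℕ, k ≤ L → κ * a k ^ 2 * (1 / ((L + 1 : ℕ) : ℝ)) ≤
      C * (a L ^ 2 + a (L + 1) ^ 2) := by
    intro L hL
    have h1 : κ * a k ^ 2 ≤ κ * ∑ m ∈ Finset.range (L + 1), a m ^ 2 := by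
      gcongr
      exact Finset.single_le_sum (f := fun m => a m ^ 2) (fun m _ => sq_nonneg _)
        (Finset.mem_range.2 (by omega))
    have h2 : Real.sqrt (L + 1) ≤ L + 1 := by
      rw [Real.sqrt_le_left (by positivity)]
      nlinarith [(Nat.cast_nonneg L : (0 : ℝ) ≤ L)]
    have h3 : a L * a (L + 1) ≤ a L ^ 2 + a (L + 1) ^ 2 := by
      nlinarith [sq_nonneg (a L - a (L + 1)), sq_nonneg (a L), sq_nonneg (a (L + 1))]
    have h4 : κ * a k ^ 2 ≤ C * (L + 1) * (a L ^ 2 + a (L + 1) ^ 2) :=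
      calc κ * a k ^ 2 ≤ C * Real.sqrt (L + 1) * (a L * a (L + 1)) := h1.trans (h L)
        _ ≤ C * Real.sqrt (L + 1) * (a L ^ 2 + a (L + 1) ^ 2) := by gcongr
        _ ≤ C * (L + 1) * (a L ^ 2 + a (L + 1) ^ 2) := by gcongr
    rw [mul_one_div, div_le_iff₀ (by positivity)]
    push_cast
    linarith
  have hsum : Summable fun L : ℕ => κ * a k ^ 2 * (1 / ((L + k + 1 : ℕ) : ℝ)) :=
    Summable.of_nonneg_of_le (fun L => by positivity) (fun L => hle (L + k) (by omega))
      ((summable_nat_add_iff k).2 hs)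
  have h1 : Summable fun L : ℕ => 1 / ((L + (k + 1) : ℕ) : ℝ) :=
    (summable_mul_left_iff hδ.ne').1 hsum
  exact Real.not_summable_one_div_natCast
    ((summable_nat_add_iff (f := fun L : ℕ => 1 / (L : ℝ)) (k + 1)).1 h1)

/-- Let `x` be square summable and let `B = ε (c + c*)`, where `c` raises the degree by one and has
norm at most `C √(m+1)` in degree `m`. If `⟨x_m, z x_m - (B x)_m⟩` is real for all `m` with
`Im z ≠ 0`, then `x = 0`: the imaginary parts of `⟨x_m, (B x)_m⟩` telescope. -/
lemma eq_zero_of_ladder {E : ℕ → Type*} [∀ m, NormedAddCommGroup (E m)]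
    [∀ m, InnerProductSpace ℂ (E m)] [∀ m, CompleteSpace (E m)]
    (c : ∀ m, E m →L[ℂ] E (m + 1)) {C : ℝ} (hC : 0 ≤ C)
    (hc : ∀ m v, ‖c m v‖ ≤ C * Real.sqrt (m + 1) * ‖v‖) (ε : ℝ) {z : ℂ} (hz : z.im ≠ 0)
    {x : ∀ m, E m} (hx : Summable fun m => ‖x m‖ ^ 2)
    (h0 : (inner ℂ (x 0)
      (z • x 0 - (ε : ℂ) • ContinuousLinearMap.adjoint (c 0) (x 1))).im = 0)
    (hs : ∀ m, (inner ℂ (x (m + 1)) (z • x (m + 1) - (ε : ℂ) •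
      (c m (x m) + ContinuousLinearMap.adjoint (c (m + 1)) (x (m + 2))))).im = 0) (m : ℕ) :
    x m = 0 := by
  let t : ℕ → ℝ := fun m => (inner ℂ (x (m + 1)) (c m (x m))).im
  have hself : ∀ m, (inner ℂ (x m) (z • x m)).im = z.im * ‖x m‖ ^ 2 := fun m => by
    have h : (inner ℂ (x m) (x m) : ℂ) = ((‖x m‖ ^ 2 : ℝ) : ℂ) := by
      rw [inner_self_eq_norm_sq_to_K]
      norm_cast
    rw [inner_smul_right, h, Complex.im_mul_ofReal]
  have hadj : ∀ m, (inner ℂ (x m) (ContinuousLinearMap.adjoint (c m) (x (m + 1)))).im = -t m :=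
    fun m => by
      rw [ContinuousLinearMap.adjoint_inner_right, ← inner_conj_symm, Complex.conj_im]
  have h0' : z.im * ‖x 0‖ ^ 2 = -(ε * t 0) := by
    rw [inner_sub_right, Complex.sub_im, hself, inner_smul_right, Complex.im_ofReal_mul,
      hadj 0] at h0
    linarith
  have hs' : ∀ m, z.im * ‖x (m + 1)‖ ^ 2 = ε * t m - ε * t (m + 1) := fun m => by
    have h := hs m
    rw [inner_sub_right, Complex.sub_im, hself, inner_smul_right, Complex.im_ofReal_mul,
      inner_add_right, Complex.add_im, hadj] at h
    linarith
  have hsum : ∀ L : ℕ, z.im * ∑ m ∈ Finset.range (L + 1), ‖x m‖ ^ 2 = -(ε * t L) := by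
    intro L
    induction L with
    | zero => simpa using h0'
    | succ L ih =>
      rw [Finset.sum_range_succ, mul_add, ih, hs']
      ring
  refine norm_eq_zero.1 (eq_zero_of_mul_sum_sq_le hx (C := |ε| * C) (κ := |z.im|) (by positivity)
    (abs_pos.2 hz) (fun L => ?_) m)
  have ht : |t L| ≤ ‖x (L + 1)‖ * (C * Real.sqrt (L + 1) * ‖x L‖) :=
    (Complex.abs_im_le_norm _).trans ((norm_inner_le_norm _ _).trans (by gcongr; exact hc L _))
  have hpos : 0 ≤ ∑ m ∈ Finset.range (L + 1), ‖x m‖ ^ 2 :=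
    Finset.sum_nonneg fun m _ => sq_nonneg _
  calc |z.im| * ∑ m ∈ Finset.range (L + 1), ‖x m‖ ^ 2
      = |ε| * |t L| := by
        rw [← abs_of_nonneg hpos, ← abs_mul, hsum, abs_neg, abs_mul]
    _ ≤ |ε| * (‖x (L + 1)‖ * (C * Real.sqrt (L + 1) * ‖x L‖)) := by gcongr
    _ = |ε| * C * Real.sqrt (L + 1) * (‖x L‖ * ‖x (L + 1)‖) := by ring

section Main

variable {d : ℕ} {ε M m₀ : ℝ} {V : Space d → ℝ} {χ : Space d → ℂ}

lemma domain_inf_finiteParticle_le_nelson (hχ : MemLp (formFactor m₀ χ) 2 volume) :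
    (freeHamiltonian d ε M m₀ V).domain ⊓ finiteParticle d ≤
      (nelsonHamiltonian ε M m₀ V hχ).domain :=
  inf_le_inf_left _ fun _ hy => (finiteParticle_le_symmetricPart ε hχ hy).1

/-- The restriction of `H` to `D(H₀) ∩ F₀` has no deficiency vectors; it is enough to test on the
vectors with a single nonzero component, on which `H` acts by `u ↦ w + H_I u` for `(u, w)` in the
graph of `H₀`. -/
lemma eq_zero_of_deficiency (hε : 0 < ε) (hM : 0 < M) {f : Space d → ℂ} (hf : MemLp f 2 volume) {z : ℂ} (hz : z.im ≠ 0)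
    {x : Fock d}
    (hx : ∀ (n m : ℕ) (u w : sector d n m), (u, w) ∈ freeSectorGraph d n m ε M m₀ V →
      inner ℂ (sectorVector w + interactionVector ε hf u) x =
        inner ℂ (sectorVector u) (z • x)) : x = 0 := by
  have hreal : ∀ n m : ℕ, (inner ℂ (x (n, m) : sector d n m)
      (z • (x (n, m) : sector d n m) - interactionComponent ε hf x (n, m))).im = 0 := by
    intro n m
    let a : sector d n m := x (n, m)
    let b : sector d n m := interactionComponent ε hf x (n, m)
    -- `a` lies in the domain of the adjoint of `H₀` on the sector, hence in the domain of `H₀`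
    have hG : (a, z • a - b) ∈ freeSectorGraph d n m ε M m₀ V := by
      refine mem_freeSectorGraph_of_forall hε hM fun u w huw => ?_
      have h := hx n m u w huw
      rw [inner_add_left, inner_sectorVector_left, inner_sectorVector_left,
        inner_interactionVector] at h
      exact (eq_sub_of_add_eq h).trans (inner_sub_right (𝕜 := ℂ) u (z • a) b).symm
    have h := inner_freeSectorGraph hG hG
    exact Complex.conj_eq_iff_im.1 ((inner_conj_symm (𝕜 := ℂ) (z • a - b) a).trans h)
  refine lp.ext (funext fun ⟨n, m⟩ => ?_)
  refine eq_zero_of_ladder (E := fun m => sector d n m) (fun m => creation n m ε hf)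
    (C := Real.sqrt ε * (n * (eLpNorm f 2 volume).toReal)) (by positivity)
    (fun m v => norm_creation_apply_le hε.le n m hf v) ε hz (x := fun m => x (n, m)) ?_
    (hreal n 0) (fun m => hreal n (m + 1)) m
  have h := (lp.memℓp x).summable (by simp)
  refine (h.comp_injective (i := fun m : ℕ => (n, m)) fun a b hab => by simpa using hab).congr
    fun m => ?_
  simp

end Main

end Nelson

end

/-- Essential self-adjointness of the Nelson Hamiltonian on `D(H₀) ∩ F₀`. -/
theorem proposition2p4 (d : ℕ) (hd : 0 < d) (ε M m₀ : ℝ) (hε : 0 < ε) (hM : 0 < M) (hm₀ : 0 ≤ m₀)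
    (V : Nelson.Space d → ℝ) (hV_nonneg : ∀ᵐ x, 0 ≤ V x)
    (hV_loc : ∀ K : Set (Nelson.Space d), IsCompact K → MemLp V 2 (volume.restrict K))
    (χ : Nelson.Space d → ℂ) (hχ : MemLp (Nelson.formFactor m₀ χ) 2 volume) :
    Nelson.IsEssentiallySelfAdjointOn (Nelson.nelsonHamiltonian ε M m₀ V hχ)
      ((Nelson.freeHamiltonian d ε M m₀ V).domain ⊓ Nelson.finiteParticle d) := by
  have hV := Nelson.locallyIntegrable_of_memLp_two_restrict hV_loc
  have hle := Nelson.domain_inf_finiteParticle_le_nelson (d := d) (ε := ε) (M := M) (V := V) hχ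
  have hdense := Nelson.dense_domain_inf_finiteParticle (m₀ := m₀) hε hM hV hV_nonneg
  refine ⟨hle, hdense, Nelson.isSelfAdjoint_closure_of_deficiency ?_ ?_ ?_⟩
  · rwa [LinearPMap.domRestrict_domain, inf_eq_left.2 hle]
  · rintro ⟨a, ha⟩ ⟨b, hb⟩
    have ea := LinearPMap.domRestrict_apply (f := Nelson.nelsonHamiltonian ε M m₀ V hχ)
      (x := ⟨a, ha⟩) (y := ⟨a, ha.2⟩) rfl
    have eb := LinearPMap.domRestrict_apply (f := Nelson.nelsonHamiltonian ε M m₀ V hχ)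
      (x := ⟨b, hb⟩) (y := ⟨b, hb.2⟩) rfl
    refine (congrArg (inner ℂ · b) ea).trans (Eq.trans ?_ (congrArg (inner ℂ a) eb).symm)
    obtain ⟨ha', hsymm⟩ := Nelson.finiteParticle_le_symmetricPart ε hχ ha.1.2
    have h1 := Nelson.freeHamiltonian_symmetric hV hV_nonneg ⟨a, ha.2.1⟩ ⟨b, hb.2.1⟩
    have h2 := hsymm ⟨b, hb.2.2⟩
    exact (inner_add_left _ _ _).trans ((congrArg₂ (· + ·) h1 h2).trans
      (inner_add_right _ _ _).symm)
  · intro z hz x hx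
    refine Nelson.eq_zero_of_deficiency (m₀ := m₀) (V := V) hε hM hχ hz
      fun n m u w huw => ?_
    have hg := Nelson.sectorVector_mem_graph hV hV_nonneg huw
    have hu := LinearPMap.mem_domain_of_mem_graph hg
    have hD : Nelson.sectorVector u ∈
        (Nelson.freeHamiltonian d ε M m₀ V).domain ⊓ Nelson.finiteParticle d :=
      ⟨hu, Nelson.sectorVector_mem_finiteParticle u⟩
    have h := hx ⟨Nelson.sectorVector u, hD, hle hD⟩
    have happly := LinearPMap.domRestrict_apply (f := Nelson.nelsonHamiltonian ε M m₀ V hχ)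
      (x := ⟨Nelson.sectorVector u, hD, hle hD⟩) (y := ⟨Nelson.sectorVector u, hle hD⟩) rfl
    have hfree : Nelson.freeHamiltonian d ε M m₀ V ⟨Nelson.sectorVector u, hu⟩ =
        Nelson.sectorVector w := ((LinearPMap.image_iff hu).2 hg).symm
    rw [← hfree, ← Nelson.interaction_sectorVector]
    exact (congrArg (inner ℂ · x) happly).symm.trans h
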